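/- **Vertex weights.** Let $q,x,y\in\mathbb C$. For $i,j,k,\ell\in\{0,1,2\}$ let $W_{y/x}(i,j;k,\ell)$ be the weight of a vertex with horizontal parameter $x$, vertical parameter $y$, and edge states $i$ (bottom, incoming), $j$ (left, incoming), $k$ (top, outgoing), $\ell$ (right, outgoing), in the nineteen-vertex Izergin--Korepin model. Put $A=x-q^2y$ and $B=(x-q^2y)(x-q^3y)$. The weights are $$\begin{aligned} &W(0,0;0,0)=W(2,2;2,2)=1,\qquad W(1,0;1,0)=W(2,1;2,1)=\tfrac{q^2(x-y)}{A},\qquad W(1,0;0,1)=W(2,1;1,2)=\tfrac{(1-q^2)x}{A},\\ &W(0,1;1,0)=W(1,2;2,1)=\tfrac{(1-q^2)y}{A},\qquad W(0,1;0,1)=W(1,2;1,2)=\tfrac{x-y}{A},\\ &W(2,0;2,0)=\tfrac{q^4(x-y)(x-qy)}{B},\quad W(2,0;1,1)=-\tfrac{q(1-q)^2(1+q)x(x-y)}{B},\quad W(2,0;0,2)=\tfrac{(1-q^2)x(x+qx-qy-q^3y)}{B},\\ &W(1,1;2,0)=-\tfrac{q^4(1+q)(x-y)y}{B},\quad W(1,1;1,1)=\tfrac{-qx^2+(1+q)(1-q^2+q^4)xy-q^4y^2}{B},\quad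 W(1,1;0,2)=\tfrac{(1+q)x(x-y)}{B},\\ &W(0,2;2,0)=\tfrac{(1-q^2)(x+q^2x-q^2y-q^3y)y}{B},\quad W(0,2;1,1)=\tfrac{q(1-q)^2(1+q)(x-y)y}{B},\quad W(0,2;0,2)=\tfrac{(x-y)(x-qy)}{B}, \end{aligned}$$ and all other weights are $0$. **The functions $F_S$.** A $2$-string is a sequence $S=(S_1,S_2,\dots)$ with entries in $\{0,1,2\}$ and only finitely many nonzero entries; $|S|=\sum_k S_k$. Let $\mathbb V=\bigoplus_S\mathbb C|S\rangle$ be the space with basis the $2$-strings, $\varnothing=(0,0,\dots)$, and $\boldsymbol z=(z_1,z_2,\dots)$. The row operator $\mathcal C(x;\boldsymbol z)\in\mathrm{End}(\mathbb V)$ sends $|J\rangle$ to $\sum_I c_{I,J}|I\rangle$, where $c_{I,J}$ is the partition function of one row of vertices $W_{z_k/x}$, $k=1,2,\dots$, with bottom states $I$, top states $J$, left boundary state $2$ and right boundary state $0$ (that is, the limit as $L\to\infty$ of the partition function of the first $L$ columns, which is eventually constant). For $|S|=2N$ put $$F_S(x_1,\dots,x_N;\boldsymbol z)=\langle\varnothing|\,\mathcal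 C(x_1;\boldsymbol z)\cdots\mathcal C(x_N;\boldsymbol z)\,|S\rangle .$$ **Twisted column operators.** Let $V_i\cong\mathbb C^3$ for $1\le i\le N$, with basis labelled $0,1,2$. A subscript $i$ on a $3\times3$ matrix means that it acts in $V_i$. With $E^{(a,b)}$ the elementary matrix with its entry $1$ in row $a$ and column $b$, define $$\begin{aligned} d_i(z)&=\mathrm{diag}\Big(1,\tfrac{x_i-z}{x_i-q^2z},\tfrac{(x_i-z)(x_i-qz)}{(x_i-q^2z)(x_i-q^3z)}\Big)_i, & d_i^{\circ}(z)&=\mathrm{diag}\Big(1,\tfrac{(qx_i-z)(x_i-q^2z)}{(1+q)(x_i-z)},\tfrac{x_i-q^3z}{x_i-qz}\Big)_i,\\ d_i^{\bullet}(z)&=\mathrm{diag}\Big(1,\tfrac{1+q}{qx_i-z},\tfrac{x_i-q^2z}{x_i-z}\Big)_i, & d_i^{\bullet\circ}(z)&=\mathrm{diag}\Big(1,\tfrac{x_i-q^2z}{x_i-z},\tfrac{(x_i-q^2z)(x_i-q^3z)}{(x_i-z)(x_i-qz)}\Big)_i, \end{aligned}$$ $$e_i^{\circ}(z)=W_{z/x_i}(0,1;1,0)\,E^{(1,0)}_i,\qquad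 e_i^{\bullet}(z)=W_{z/x_i}(0,2;1,1)\,E^{(2,1)}_i,\qquad e_i^{\bullet\circ}(z)=W_{z/x_i}(0,2;2,0)\,E^{(2,0)}_i,$$ and, for $i\ne j$, $$\begin{aligned} e_{ij}^{\circ\circ}(z)&=\tfrac{x_ix_j+q^2x_ix_j-q^2x_iz-q^2x_jz}{(1-q^2)z}\,e_i^{\circ}(z)e_j^{\circ}(z),\\ e_{ij}^{\bullet\circ}(z)=e_{ji}^{\circ\bullet}(z)&=\tfrac{x_ix_j+q^2x_ix_j-q^2x_iz-q^3x_jz}{q(1-q)(x_i-x_j)z}\,e_i^{\bullet}(z)e_j^{\circ}(z),\\ e_{ij}^{\bullet\bullet}(z)&=\tfrac{(1+q)(x_ix_j+q^2x_ix_j-q^3x_iz-q^3x_jz)}{q(1-q)(x_i-qx_j)(x_j-qx_i)z}\,e_i^{\bullet}(z)e_j^{\bullet}(z) \end{aligned}$$ (for $z=0$ these products are taken to be $0$, which is their value after cancelling the factor $z$). The twisted column operators on $V_1\otimes\cdots\otimes V_N$ are $$\Gamma_0(z)=\prod_{i=1}^N d_i(z),\qquad \Gamma_1(z)=\sum_{u\in\{\circ,\bullet\}}\sum_{i=1}^N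 e_i^u(z)\prod_{j\ne i}d_j(z)d_j^u(x_i),$$ $$\Gamma_2(z)=\sum_{i=1}^N e_i^{\bullet\circ}(z)\prod_{j\neq i}d_j(z)d_j^{\bullet\circ}(x_i)+\sum_{u,v\in\{\circ,\bullet\}}\ \sum_{1\le i<j\le N}e_{ij}^{uv}(z)\prod_{k\ne i,j}d_k(z)d_k^u(x_i)d_k^v(x_j).$$ Let $\langle\!\langle 2^N\|=\bigotimes_{i=1}^N(0\ 0\ 1)_i$ and $\|0^N\rangle\!\rangle=\bigotimes_{i=1}^N(1\ 0\ 0)^{T}_i$. **Theorem.** Let $N\ge1$ and let $S$ be a $2$-string with $|S|=2N$. Let $q,x_1,\dots,x_N,z_1,z_2,\dots\in\mathbb C$ be such that no denominator vanishes in the expressions above (apart from the removable factor $z$ of $e_{ij}^{uv}(z)$), that is: $q\notin\{0,1,-1\}$; $x_i\ne x_j$ and $x_i\ne qx_j$ for all $i\ne j$; and $x_i\ne q^2z_k$, $x_i\neq q^3z_k$ for all $i,k$. Then $$F_S(x_1,\dots,x_N;\boldsymbol z)=\langle\!\langle 2^N\|\,\Gamma_{S_1}(z_1)\Gamma_{S_2}(z_2)\Gamma_{S_3}(z_3)\cdots\,\|0^N\rangle\!\rangle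 ,$$ where the infinite product is read as $\Gamma_{S_1}(z_1)\cdots\Gamma_{S_L}(z_L)$ for any $L$ such that $S_k=0$ for all $k>L$; the equality holds for every such $L$. -/

import Mathlib

open scoped BigOperators

namespace IzerginKorepin

/-! Indexing: lattice columns and rows are numbered from `0` here, so `S k`, `z k`, `x i` stand for
`S_{k+1}`, `z_{k+1}`, `x_{i+1}`. -/

/-- The vertex weight `W_{y/x}(i,j;k,l)` of the nineteen-vertex Izergin-Korepin model: `x` is the
horizontal and `y` the vertical spectral parameter, and the edge states are read clockwise:
`i` bottom (incoming), `j` left (incoming), `k` top (outgoing), `l` right (outgoing). -/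
noncomputable def weight (q x y : ℂ) : Fin 3 → Fin 3 → Fin 3 → Fin 3 → ℂ
  | 0, 0, 0, 0 => 1
  | 1, 0, 1, 0 => q ^ 2 * (x - y) / (x - q ^ 2 * y)
  | 1, 0, 0, 1 => (1 - q ^ 2) * x / (x - q ^ 2 * y)
  | 2, 0, 2, 0 => q ^ 4 * (x - y) * (x - q * y) / ((x - q ^ 2 * y) * (x - q ^ 3 * y))
  | 2, 0, 1, 1 =>
      -(q * (1 - q) ^ 2 * (1 + q) * x * (x - y) / ((x - q ^ 2 * y) * (x - q ^ 3 * y)))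
  | 2, 0, 0, 2 =>
      (1 - q ^ 2) * x * (x + q * x - q * y - q ^ 3 * y) / ((x - q ^ 2 * y) * (x - q ^ 3 * y))
  | 0, 1, 1, 0 => (1 - q ^ 2) * y / (x - q ^ 2 * y)
  | 0, 1, 0, 1 => (x - y) / (x - q ^ 2 * y)
  | 1, 1, 2, 0 => -(q ^ 4 * (1 + q) * (x - y) * y / ((x - q ^ 2 * y) * (x - q ^ 3 * y)))
  | 1, 1, 1, 1 =>
      (-(q * x ^ 2) + (1 + q) * (1 - q ^ 2 + q ^ 4) * x * y - q ^ 4 * y ^ 2) /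
        ((x - q ^ 2 * y) * (x - q ^ 3 * y))
  | 1, 1, 0, 2 => (1 + q) * x * (x - y) / ((x - q ^ 2 * y) * (x - q ^ 3 * y))
  | 2, 1, 2, 1 => q ^ 2 * (x - y) / (x - q ^ 2 * y)
  | 2, 1, 1, 2 => (1 - q ^ 2) * x / (x - q ^ 2 * y)
  | 0, 2, 2, 0 =>
      (1 - q ^ 2) * (x + q ^ 2 * x - q ^ 2 * y - q ^ 3 * y) * y /
        ((x - q ^ 2 * y) * (x - q ^ 3 * y))
  | 0, 2, 1, 1 =>
      q * (1 - q) ^ 2 * (1 + q) * (x - y) * y / ((x - q ^ 2 * y) * (x - q ^ 3 * y))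
  | 0, 2, 0, 2 => (x - y) * (x - q * y) / ((x - q ^ 2 * y) * (x - q ^ 3 * y))
  | 1, 2, 2, 1 => (1 - q ^ 2) * y / (x - q ^ 2 * y)
  | 1, 2, 1, 2 => (x - y) / (x - q ^ 2 * y)
  | 2, 2, 2, 2 => 1
  | _, _, _, _ => 0

/-! ### Row operators and the functions `F_S` -/

/-- The finite row operator `T_{a,b}(x; z)` on `V_1 ⊗ ⋯ ⊗ V_L`, as a matrix: the entry `(J, I)` is
the one-row partition function with bottom states `J`, top states `I`, left state `a` and right
state `b`; `h` runs over the labellings of the horizontal edges. -/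
noncomputable def rowOp (q x : ℂ) (z : ℕ → ℂ) (L : ℕ) (a b : Fin 3) :
    Matrix (Fin L → Fin 3) (Fin L → Fin 3) ℂ :=
  Matrix.of fun J I =>
    ∑ h : Fin (L + 1) → Fin 3,
      if h 0 = a ∧ h (Fin.last L) = b then
        ∏ k : Fin L, weight q x (z k) (J k) (h k.castSucc) (I k) (h k.succ)
      else 0

/-- A `2`-string: a sequence in `{0,1,2}` with finitely many nonzero entries. -/
abbrev TwoString : Type := ℕ →₀ Fin 3

/-- The weight `|S|`, the sum of the entries of `S`. -/
def TwoString.size (S : TwoString) : ℕ := ∑ k ∈ S.support, (S k : ℕ)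

/-- The smallest `M` such that all entries of `S` from position `M` on vanish. -/
def TwoString.length (S : TwoString) : ℕ := S.support.sup (fun k => k + 1)

/-- The `2`-string obtained from `I` by appending zeros. -/
noncomputable def extend {L : ℕ} (I : Fin L → Fin 3) : TwoString :=
  Finsupp.onFinset (Finset.range L) (fun k => if h : k < L then I ⟨k, h⟩ else 0) (by
    intro k hk
    by_contra hn
    exact hk (dif_neg (by simpa using hn)))

/-- The infinite-volume space, with basis the `2`-strings. -/
abbrev FockSpace : Type := TwoString →₀ ℂ

/-- The basis vector `|S⟩`. -/
noncomputable def ket (S : TwoString) : FockSpace := Finsupp.single S 1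

/-- `T_{2,0}(x; z)|S⟩` computed on the first `L` columns, where `S` is restricted to these. -/
noncomputable def truncC (q : ℂ) (z : ℕ → ℂ) (x : ℂ) (L : ℕ) (S : TwoString) : FockSpace :=
  ∑ I : Fin L → Fin 3, rowOp q x z L 2 0 I (fun k => S k) • ket (extend I)

/-- The row operator `C(x; z) = lim_{L → ∞} T_{2,0}(x; z)`. On `|S⟩` the limit is attained as soon
as the first `L` columns contain all nonzero entries of `S`, see `opC_ket`. -/
noncomputable def opC (q : ℂ) (z : ℕ → ℂ) (x : ℂ) : Module.End ℂ FockSpace :=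
  Finsupp.linearCombination ℂ (fun S : TwoString => truncC q z x S.length S)

/-- `F_S(x_1,…,x_N; z) = ⟨∅| C(x_1; z) ⋯ C(x_N; z) |S⟩`. -/
noncomputable def F (q : ℂ) {N : ℕ} (x : Fin N → ℂ) (z : ℕ → ℂ) (S : TwoString) : ℂ :=
  ((List.ofFn fun i => opC q z (x i)).prod (ket S)) 0

theorem weight_top_right_zero (q x y : ℂ) (i j : Fin 3) :
    weight q x y i j 0 0 = if i = 0 ∧ j = 0 then 1 else 0 := by
  fin_cases i <;> fin_cases j <;> simp [weight]

theorem rowOp_snoc (q x : ℂ) (z : ℕ → ℂ) (L : ℕ) (a : Fin 3) (J : Fin L → Fin 3) (j : Fin 3)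
    (I : Fin (L + 1) → Fin 3) (hI : I (Fin.last L) = 0) :
    rowOp q x z (L + 1) a 0 (Fin.snoc (α := fun _ => Fin 3) J j) I =
      if j = 0 then rowOp q x z L a 0 J (fun k => I k.castSucc) else 0 := by
  simp only [rowOp, Matrix.of_apply]
  rw [← (Fin.snocEquiv (fun _ : Fin (L + 2) => Fin 3)).sum_comp, Fintype.sum_prod_type]
  have h0 : ∀ (t : Fin 3) (h : Fin (L + 1) → Fin 3),
      (Fin.snoc (α := fun _ => Fin 3) h t : Fin (L + 2) → Fin 3) 0 = h 0 := fun t h => by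
    rw [← Fin.castSucc_zero]; exact Fin.snoc_castSucc (α := fun _ => Fin 3) t h 0
  have hs : ∀ (t : Fin 3) (h : Fin (L + 1) → Fin 3) (k : Fin L),
      (Fin.snoc (α := fun _ => Fin 3) h t : Fin (L + 2) → Fin 3) k.castSucc.succ = h k.succ :=
    fun t h k => by
      rw [Fin.succ_castSucc]; exact Fin.snoc_castSucc (α := fun _ => Fin 3) t h k.succ
  rw [Finset.sum_eq_single_of_mem 0 (Finset.mem_univ _)]
  · by_cases hj : j = 0
    · simp only [Fin.snocEquiv, Equiv.coe_fn_mk, Fin.prod_univ_castSucc, Fin.snoc_castSucc,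
        Fin.snoc_last, Fin.succ_last, hI, weight_top_right_zero, h0, hs, hj, Fin.val_castSucc,
        Fin.val_last, true_and, and_true, if_true]
      refine Finset.sum_congr rfl fun h _ => ?_
      by_cases ha : h 0 = a <;> by_cases hb : h (Fin.last L) = 0 <;> simp [ha, hb]
    · simp only [Fin.snocEquiv, Equiv.coe_fn_mk, Fin.prod_univ_castSucc, Fin.snoc_castSucc,
        Fin.snoc_last, Fin.succ_last, hI, weight_top_right_zero, hj, false_and, if_false,
        mul_zero, ite_self, Finset.sum_const_zero]
  · intro t _ ht
    simp [Fin.snocEquiv, ht]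

theorem extend_snoc_zero {L : ℕ} (I : Fin L → Fin 3) :
    extend (Fin.snoc (α := fun _ => Fin 3) I 0 : Fin (L + 1) → Fin 3) = extend I := by
  ext k : 1
  simp only [extend, Finsupp.onFinset_apply]
  by_cases h : k < L
  · rw [dif_pos (Nat.lt_succ_of_lt h), dif_pos h]
    exact Fin.snoc_castSucc (α := fun _ => Fin 3) 0 I ⟨k, h⟩
  · rw [dif_neg h]
    split_ifs with h'
    · have : (⟨k, h'⟩ : Fin (L + 1)) = Fin.last L := Fin.ext (by simp; omega)
      rw [this]; exact Fin.snoc_last (α := fun _ => Fin 3) 0 I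
    · rfl

theorem truncC_succ (q : ℂ) (z : ℕ → ℂ) (x : ℂ) (L : ℕ) (S : TwoString) (hS : S L = 0) :
    truncC q z x (L + 1) S = truncC q z x L S := by
  unfold truncC
  rw [← (Fin.snocEquiv (fun _ : Fin (L + 1) => Fin 3)).sum_comp, Fintype.sum_prod_type,
    Finset.sum_eq_single_of_mem 0 (Finset.mem_univ _)]
  · refine Finset.sum_congr rfl fun I _ => ?_
    simp only [Fin.snocEquiv, Equiv.coe_fn_mk]
    rw [rowOp_snoc _ _ _ _ _ _ _ _ (by simpa using hS), if_pos rfl, extend_snoc_zero]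
    rfl
  · intro t _ ht
    refine Finset.sum_eq_zero fun I _ => ?_
    simp only [Fin.snocEquiv, Equiv.coe_fn_mk]
    rw [rowOp_snoc _ _ _ _ _ _ _ _ (by simpa using hS), if_neg ht, zero_smul]

theorem TwoString.length_le {S : TwoString} {L : ℕ} (hL : ∀ k, L ≤ k → S k = 0) :
    S.length ≤ L := by
  refine Finset.sup_le fun k hk => ?_
  by_contra hn
  exact Finsupp.mem_support_iff.mp hk (hL k (by omega))

theorem TwoString.eq_zero_of_length_le {S : TwoString} {k : ℕ} (hk : S.length ≤ k) : S k = 0 := by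
  by_contra hn
  have := Finset.le_sup (f := fun k => k + 1) (Finsupp.mem_support_iff.mpr hn)
  unfold TwoString.length at hk
  omega

/-- `C(x; z)|S⟩` is the common value of `T_{2,0}(x; z)|S⟩` for all sufficiently large `L`. -/
theorem opC_ket (q : ℂ) (z : ℕ → ℂ) (x : ℂ) (S : TwoString) (L : ℕ)
    (hL : ∀ k, L ≤ k → S k = 0) : opC q z x (ket S) = truncC q z x L S := by
  have h1 : opC q z x (ket S) = truncC q z x S.length S := by
    simp [opC, ket, Finsupp.linearCombination_single]
  rw [h1]
  obtain ⟨n, rfl⟩ := Nat.exists_eq_add_of_le (TwoString.length_le hL)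
  clear hL h1
  induction n with
  | zero => rfl
  | succ n ih =>
    rw [ih, ← Nat.add_assoc,
      truncC_succ q z x _ S (TwoString.eq_zero_of_length_le (Nat.le_add_right _ _))]

/-! ### Twisted column operators -/

/-- The two dots `∘` and `•`. -/
inductive Dot : Type
  | circ : Dot
  | bull : Dot
  deriving DecidableEq

instance : Fintype Dot where
  elems := {Dot.circ, Dot.bull}
  complete u := by cases u <;> simp

/-- The diagonal matrix `d_i(z)`, with `x = x_i`. -/
noncomputable def d (q x z : ℂ) : Matrix (Fin 3) (Fin 3) ℂ :=
  Matrix.diagonal ![1, (x - z) / (x - q ^ 2 * z),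
    (x - z) * (x - q * z) / ((x - q ^ 2 * z) * (x - q ^ 3 * z))]

/-- The diagonal matrices `d_i^∘(z)` and `d_i^•(z)`, with `x = x_i`. -/
noncomputable def dDot (q x z : ℂ) : Dot → Matrix (Fin 3) (Fin 3) ℂ
  | .circ => Matrix.diagonal ![1, (q * x - z) * (x - q ^ 2 * z) / ((1 + q) * (x - z)),
      (x - q ^ 3 * z) / (x - q * z)]
  | .bull => Matrix.diagonal ![1, (1 + q) / (q * x - z), (x - q ^ 2 * z) / (x - z)]

/-- The diagonal matrix `d_i^{•∘}(z)`, with `x = x_i`. -/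
noncomputable def dBoth (q x z : ℂ) : Matrix (Fin 3) (Fin 3) ℂ :=
  Matrix.diagonal ![1, (x - q ^ 2 * z) / (x - z),
    (x - q ^ 2 * z) * (x - q ^ 3 * z) / ((x - z) * (x - q * z))]

/-- The matrices `e_i^∘(z)` and `e_i^•(z)`, with `x = x_i`. -/
noncomputable def eDot (q x z : ℂ) : Dot → Matrix (Fin 3) (Fin 3) ℂ
  | .circ => ((1 - q ^ 2) * z / (x - q ^ 2 * z)) • !![0, 0, 0; 1, 0, 0; 0, 0, 0]
  | .bull => (q * (1 - q) ^ 2 * (1 + q) * (x - z) * z / ((x - q ^ 2 * z) * (x - q ^ 3 * z))) •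
      !![0, 0, 0; 0, 0, 0; 0, 1, 0]

/-- The matrix `e_i^{•∘}(z)`, with `x = x_i`. -/
noncomputable def eBoth (q x z : ℂ) : Matrix (Fin 3) (Fin 3) ℂ :=
  ((1 - q ^ 2) * (x + q ^ 2 * x - q ^ 2 * z - q ^ 3 * z) * z /
    ((x - q ^ 2 * z) * (x - q ^ 3 * z))) • !![0, 0, 0; 0, 0, 0; 1, 0, 0]

/-- The scalar `c` in `e_{ij}^{uv}(z) = c · e_i^u(z) e_j^v(z)`, with `x = x_i`, `y = x_j`. The case
`∘•` is determined by `e_{ij}^{∘•}(z) = e_{ji}^{•∘}(z)`. The factor `z` in the denominator cancels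
against the factors `z` of `e_i^u(z)` and `e_j^v(z)`; at `z = 0` the product vanishes, both here
(where division by zero gives zero) and after the cancellation. -/
noncomputable def pairCoeff (q x y z : ℂ) : Dot → Dot → ℂ
  | .circ, .circ =>
      (x * y + q ^ 2 * x * y - q ^ 2 * x * z - q ^ 2 * y * z) / ((1 - q ^ 2) * z)
  | .bull, .circ =>
      (x * y + q ^ 2 * x * y - q ^ 2 * x * z - q ^ 3 * y * z) / (q * (1 - q) * (x - y) * z)
  | .circ, .bull =>
      (y * x + q ^ 2 * y * x - q ^ 2 * y * z - q ^ 3 * x * z) / (q * (1 - q) * (y - x) * z)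
  | .bull, .bull =>
      (1 + q) * (x * y + q ^ 2 * x * y - q ^ 3 * x * z - q ^ 3 * y * z) /
        (q * (1 - q) * (x - q * y) * (y - q * x) * z)

/-- The tensor product `A_1 ⊗ ⋯ ⊗ A_N` of local matrices, as a `3^N × 3^N` matrix. -/
def tensor {N : ℕ} (A : Fin N → Matrix (Fin 3) (Fin 3) ℂ) :
    Matrix (Fin N → Fin 3) (Fin N → Fin 3) ℂ :=
  Matrix.of fun a b => ∏ i, A i (a i) (b i)

/-- The twisted column operator `Γ_0(z)`. -/
noncomputable def Gamma0 (q : ℂ) {N : ℕ} (x : Fin N → ℂ) (z : ℂ) :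
    Matrix (Fin N → Fin 3) (Fin N → Fin 3) ℂ :=
  tensor fun i => d q (x i) z

/-- The twisted column operator `Γ_1(z)`. -/
noncomputable def Gamma1 (q : ℂ) {N : ℕ} (x : Fin N → ℂ) (z : ℂ) :
    Matrix (Fin N → Fin 3) (Fin N → Fin 3) ℂ :=
  ∑ u : Dot, ∑ i : Fin N,
    tensor fun j => if j = i then eDot q (x i) z u else d q (x j) z * dDot q (x j) (x i) u

/-- The twisted column operator `Γ_2(z)`. -/
noncomputable def Gamma2 (q : ℂ) {N : ℕ} (x : Fin N → ℂ) (z : ℂ) :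
    Matrix (Fin N → Fin 3) (Fin N → Fin 3) ℂ :=
  (∑ i : Fin N,
    tensor fun j => if j = i then eBoth q (x i) z else d q (x j) z * dBoth q (x j) (x i)) +
  ∑ u : Dot, ∑ v : Dot, ∑ i : Fin N, ∑ j ∈ Finset.Ioi i,
    pairCoeff q (x i) (x j) z u v •
      tensor fun k =>
        if k = i then eDot q (x i) z u
        else if k = j then eDot q (x j) z v
        else d q (x k) z * dDot q (x k) (x i) u * dDot q (x k) (x j) v

/-- The twisted column operators `Γ_k(z)`, `k ∈ {0,1,2}`. -/
noncomputable def Gamma (q : ℂ) {N : ℕ} (x : Fin N → ℂ) (k : Fin 3) (z : ℂ) :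
    Matrix (Fin N → Fin 3) (Fin N → Fin 3) ℂ :=
  match k with
  | 0 => Gamma0 q x z
  | 1 => Gamma1 q x z
  | 2 => Gamma2 q x z

/-- The covector `⟪2^N‖`, the tensor product of `N` copies of `(0 0 1)`. -/
def bra2 (N : ℕ) : (Fin N → Fin 3) → ℂ := fun a => ∏ i, (![0, 0, 1] : Fin 3 → ℂ) (a i)

/-- The vector `‖0^N⟫`, the tensor product of `N` copies of `(1 0 0)`. -/
def ket0 (N : ℕ) : (Fin N → Fin 3) → ℂ := fun a => ∏ i, (![1, 0, 0] : Fin 3 → ℂ) (a i)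

/-- `Γ_{S_1}(z_1) ⋯ Γ_{S_L}(z_L)`. -/
noncomputable def GammaProd (q : ℂ) {N : ℕ} (x : Fin N → ℂ) (z : ℕ → ℂ) (S : TwoString) (L : ℕ) :
    Matrix (Fin N → Fin 3) (Fin N → Fin 3) ℂ :=
  (List.ofFn fun k : Fin L => Gamma q x (S k) (z k)).prod

end IzerginKorepin

namespace IzerginKorepin

/-! ### Tensor monomials -/

/-! Removing the top row gives `F` a recursion in the number of rows (`F_succ`): the value for $n+1$
rows is a sum over $I$ of a one-row partition function with parameter $w=x_{n+1}$ times
$F_I(x_1,\dots,x_n)$. The theorem holds because the matrix element of the product of twisted column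
operators obeys the same recursion (`GammaProd_succ`), and for $n=0$ both sides are $1$ for
$S=\varnothing$ and $0$ otherwise.

To obtain the second recursion, operators on $n+1$ sites are written as $3\times3$ block matrices
over the last site (`blk`). Placing an ordinary row with parameter $w$ on top of the $n$-site
twisted operators gives the blocks `addRow`, whose products expand into one-row partition functions
(`addRow_list_prod`). The central fact, `blk_Gamma_mul_intertwiner`, is
$\Gamma_k(z)\,G=G\cdot\mathtt{addRow}_k(z)$ with a block upper triangular $G$ that depends on $w$
but not on $z$ or $k$. Hence $G$ passes through the whole product. Its bottom row is $(0,0,1)$ and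
its first column is $(\Gamma_0(w),0,0)^T$, so the $(2,0)$ blocks of the two products differ only by
a factor $\Gamma_0(w)$ on the right, which fixes the vector $0^n$.

For $k=0$ the intertwining relation reduces to rational identities that involve at most two sites.
For $k=1,2$ it is deduced from the limits $K=\Gamma_0(\infty)$ and $E=\Gamma_1(\infty)$: the
relations `opE_mul_Gamma0` and `opE_mul_Gamma1` express $\Gamma_1$ and $\Gamma_2$ through
$\Gamma_0$, $E$ and the invertible $K$. The operators `addRow` satisfy the same relations with
`addRowE` and `addRowK`, so it suffices to intertwine $\Gamma_0$, $E$ and $K$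
(`intertwine_transfer`).

This uses one further relation, $E\,\Gamma_2=q^{-2}\,\Gamma_2E$. Its direct verification would
involve three sites at once. Instead `columnRelations_Gamma` proves it by induction on $n$: the
relations on $n$ sites provide the intertwiner for $n+1$ sites, the `addRow` version of the relation
is transported through $G$, and $G$ is cancelled.

The intertwiner requires $x_i\ne q^2x_j$ and $x_i\ne q^3x_j$ for $i\ne j$. These conditions are
removed at the end by perturbing the $x_i$ and using continuity. -/

theorem tensor_mul {n : ℕ} (A B : Fin n → Matrix (Fin 3) (Fin 3) ℂ) :
    tensor A * tensor B = tensor fun i => A i * B i := by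
  ext a b
  simp only [tensor, Matrix.mul_apply, Matrix.of_apply, ← Finset.prod_mul_distrib]
  rw [Finset.prod_univ_sum, Fintype.piFinset_univ]

theorem tensor_update_smul {n : ℕ} (A : Fin n → Matrix (Fin 3) (Fin 3) ℂ) (i : Fin n) (c : ℂ)
    (M : Matrix (Fin 3) (Fin 3) ℂ) :
    tensor (Function.update A i (c • M)) = c • tensor (Function.update A i M) := by
  ext a b
  simp only [tensor, Matrix.of_apply, Matrix.smul_apply, smul_eq_mul]
  rw [← Finset.mul_prod_erase _ _ (Finset.mem_univ i),
    ← Finset.mul_prod_erase Finset.univ _ (Finset.mem_univ i)]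
  simp only [Function.update_self, Matrix.smul_apply, smul_eq_mul, mul_assoc]
  congr 2
  refine Finset.prod_congr rfl fun k hk => ?_
  simp only [Function.update_of_ne (Finset.ne_of_mem_erase hk)]

/-- The state before the event marked by a dot. -/
def Dot.src : Dot → Fin 3
  | .circ => 0
  | .bull => 1

/-- The state after the event marked by a dot. -/
def Dot.tgt : Dot → Fin 3
  | .circ => 1
  | .bull => 2

/-- The elementary matrix `E^{(1,0)}` or `E^{(2,1)}` marked by a dot. -/
def elemDot : Dot → Matrix (Fin 3) (Fin 3) ℂ
  | .circ => !![0, 0, 0; 1, 0, 0; 0, 0, 0]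
  | .bull => !![0, 0, 0; 0, 0, 0; 0, 1, 0]

/-- The elementary matrix `E^{(2,0)}`. -/
def elemBoth : Matrix (Fin 3) (Fin 3) ℂ := !![0, 0, 0; 0, 0, 0; 1, 0, 0]

theorem elemDot_mul_diagonal (u : Dot) (f : Fin 3 → ℂ) :
    elemDot u * Matrix.diagonal f = f u.src • elemDot u := by
  ext a b
  cases u <;> fin_cases a <;> fin_cases b <;> simp [elemDot, Dot.src]

theorem diagonal_mul_elemDot (u : Dot) (f : Fin 3 → ℂ) :
    Matrix.diagonal f * elemDot u = f u.tgt • elemDot u := by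
  ext a b
  cases u <;> fin_cases a <;> fin_cases b <;> simp [elemDot, Dot.tgt]

theorem elemBoth_mul_diagonal (f : Fin 3 → ℂ) :
    elemBoth * Matrix.diagonal f = f 0 • elemBoth := by
  ext a b
  fin_cases a <;> fin_cases b <;> simp [elemBoth]

theorem diagonal_mul_elemBoth (f : Fin 3 → ℂ) :
    Matrix.diagonal f * elemBoth = f 2 • elemBoth := by
  ext a b
  fin_cases a <;> fin_cases b <;> simp [elemBoth]

/-- At one site the only composable pair is $0\to1$ followed by $1\to2$; this is the origin of the
terms with $E^{(2,0)}$. -/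
theorem elemDot_mul_elemDot (u v : Dot) :
    elemDot u * elemDot v = (if u = .bull ∧ v = .circ then (1 : ℂ) else 0) • elemBoth := by
  ext a b
  cases u <;> cases v <;> fin_cases a <;> fin_cases b <;>
    simp [elemDot, elemBoth, Matrix.mul_apply, Fin.sum_univ_three]

/-- The tensor product of diagonal matrices. -/
def opDiag {n : ℕ} (δ : Fin n → Fin 3 → ℂ) : Matrix (Fin n → Fin 3) (Fin n → Fin 3) ℂ :=
  tensor fun k => Matrix.diagonal (δ k)

/-- The tensor product of diagonal matrices with the factor at `i` replaced by `A`. -/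
def monoOne {n : ℕ} (δ : Fin n → Fin 3 → ℂ) (i : Fin n) (A : Matrix (Fin 3) (Fin 3) ℂ) :
    Matrix (Fin n → Fin 3) (Fin n → Fin 3) ℂ :=
  tensor (Function.update (fun k => Matrix.diagonal (δ k)) i A)

/-- The tensor product of diagonal matrices with the factors at `i`, `j` replaced by `A`, `B`. -/
def monoTwo {n : ℕ} (δ : Fin n → Fin 3 → ℂ) (i : Fin n) (A : Matrix (Fin 3) (Fin 3) ℂ)
    (j : Fin n) (B : Matrix (Fin 3) (Fin 3) ℂ) : Matrix (Fin n → Fin 3) (Fin n → Fin 3) ℂ :=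
  tensor (Function.update (Function.update (fun k => Matrix.diagonal (δ k)) i A) j B)

section Mono

variable {n : ℕ} (δ δ' : Fin n → Fin 3 → ℂ) (i j : Fin n) (A B : Matrix (Fin 3) (Fin 3) ℂ) (c : ℂ)

theorem monoOne_smul : monoOne δ i (c • A) = c • monoOne δ i A := tensor_update_smul _ _ _ _

theorem monoTwo_comm (hij : i ≠ j) : monoTwo δ i A j B = monoTwo δ j B i A := by
  unfold monoTwo
  rw [Function.update_comm hij]

theorem monoTwo_smul_right : monoTwo δ i A j (c • B) = c • monoTwo δ i A j B :=
  tensor_update_smul _ _ _ _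

theorem monoTwo_smul_left (hij : i ≠ j) : monoTwo δ i (c • A) j B = c • monoTwo δ i A j B := by
  rw [monoTwo_comm _ _ _ _ _ hij, monoTwo_smul_right, monoTwo_comm _ _ _ _ _ hij]

theorem opDiag_mul_opDiag : opDiag δ * opDiag δ' = opDiag (δ * δ') := by
  unfold opDiag
  rw [tensor_mul]
  congr 1
  funext k
  exact Matrix.diagonal_mul_diagonal _ _

theorem opDiag_mul_monoOne :
    opDiag δ * monoOne δ' i A = monoOne (δ * δ') i (Matrix.diagonal (δ i) * A) := by
  unfold opDiag monoOne
  rw [tensor_mul]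
  congr 1
  funext k
  by_cases hk : k = i
  · subst hk; simp
  · simp only [Function.update_of_ne hk]; exact Matrix.diagonal_mul_diagonal _ _

theorem monoOne_mul_opDiag :
    monoOne δ i A * opDiag δ' = monoOne (δ * δ') i (A * Matrix.diagonal (δ' i)) := by
  unfold opDiag monoOne
  rw [tensor_mul]
  congr 1
  funext k
  by_cases hk : k = i
  · subst hk; simp
  · simp only [Function.update_of_ne hk]; exact Matrix.diagonal_mul_diagonal _ _

theorem opDiag_mul_monoTwo (hij : i ≠ j) :
    opDiag δ * monoTwo δ' i A j B =
      monoTwo (δ * δ') i (Matrix.diagonal (δ i) * A) j (Matrix.diagonal (δ j) * B) := by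
  unfold opDiag monoTwo
  rw [tensor_mul]
  congr 1
  funext k
  by_cases hk : k = i
  · subst hk; simp [Function.update_of_ne hij]
  · by_cases hk' : k = j
    · subst hk'; simp
    · simp only [Function.update_of_ne hk, Function.update_of_ne hk']
      exact Matrix.diagonal_mul_diagonal _ _

theorem monoTwo_mul_opDiag (hij : i ≠ j) :
    monoTwo δ i A j B * opDiag δ' =
      monoTwo (δ * δ') i (A * Matrix.diagonal (δ' i)) j (B * Matrix.diagonal (δ' j)) := by
  unfold opDiag monoTwo
  rw [tensor_mul]
  congr 1
  funext k
  by_cases hk : k = i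
  · subst hk; simp [Function.update_of_ne hij]
  · by_cases hk' : k = j
    · subst hk'; simp
    · simp only [Function.update_of_ne hk, Function.update_of_ne hk']
      exact Matrix.diagonal_mul_diagonal _ _

theorem monoOne_mul_monoOne_self :
    monoOne δ i A * monoOne δ' i B = monoOne (δ * δ') i (A * B) := by
  unfold monoOne
  rw [tensor_mul]
  congr 1
  funext k
  by_cases hk : k = i
  · subst hk; simp
  · simp only [Function.update_of_ne hk]; exact Matrix.diagonal_mul_diagonal _ _

theorem monoOne_mul_monoOne (hij : i ≠ j) :
    monoOne δ i A * monoOne δ' j B =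
      monoTwo (δ * δ') i (A * Matrix.diagonal (δ' i)) j (Matrix.diagonal (δ j) * B) := by
  unfold monoOne monoTwo
  rw [tensor_mul]
  congr 1
  funext k
  by_cases hk : k = i
  · subst hk; simp [Function.update_of_ne hij]
  · by_cases hk' : k = j
    · subst hk'; simp [Function.update_of_ne hk]
    · simp only [Function.update_of_ne hk, Function.update_of_ne hk']
      exact Matrix.diagonal_mul_diagonal _ _

end Mono

/-! ### Operators with one or two events -/

/-- The diagonal of `d_k^u(x_i)`, as a function of `k`. -/
noncomputable def spect (q : ℂ) {n : ℕ} (x : Fin n → ℂ) (i : Fin n) (u : Dot) :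
    Fin n → Fin 3 → ℂ := fun k => (dDot q (x k) (x i) u).diag

/-- The sum over all single events, with coefficients `α` and common diagonal factors `δ`. -/
noncomputable def opOne (q : ℂ) {n : ℕ} (x : Fin n → ℂ) (δ : Fin n → Fin 3 → ℂ)
    (α : Fin n → Dot → ℂ) : Matrix (Fin n → Fin 3) (Fin n → Fin 3) ℂ :=
  -- `monoOne` overwrites the diagonal at site `i`, so the spurious value of `spect q x i u` at `i`
  -- itself, where `dDot` divides by zero, never enters.
  ∑ i, ∑ u, α i u • monoOne (δ * spect q x i u) i (elemDot u)

/-- The sum over all pairs of events, with coefficients `γ` for two events at one site and `β` for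
events at two sites, and common diagonal factors `δ`. -/
noncomputable def opTwo (q : ℂ) {n : ℕ} (x : Fin n → ℂ) (δ : Fin n → Fin 3 → ℂ)
    (β : Fin n → Dot → Fin n → Dot → ℂ) (γ : Fin n → ℂ) :
    Matrix (Fin n → Fin 3) (Fin n → Fin 3) ℂ :=
  (∑ i, γ i • monoOne (δ * (spect q x i .circ * spect q x i .bull)) i elemBoth) +
    ∑ i, ∑ j, if i = j then 0 else ∑ u, ∑ v,
      β i u j v • monoTwo (δ * (spect q x i u * spect q x j v)) i (elemDot u) j (elemDot v)

section Ops

variable {q : ℂ} {n : ℕ} {x : Fin n → ℂ} (δ δ' : Fin n → Fin 3 → ℂ)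
  (α α' : Fin n → Dot → ℂ) (β β' : Fin n → Dot → Fin n → Dot → ℂ) (γ γ' : Fin n → ℂ) (c : ℂ)

theorem opOne_add : opOne q x δ α + opOne q x δ α' = opOne q x δ (α + α') := by
  simp only [opOne, Pi.add_apply, add_smul, Finset.sum_add_distrib]

theorem opOne_smul : c • opOne q x δ α = opOne q x δ (c • α) := by
  simp only [opOne, Pi.smul_apply, Finset.smul_sum, smul_smul, smul_eq_mul]

theorem opTwo_add :
    opTwo q x δ β γ + opTwo q x δ β' γ' = opTwo q x δ (β + β') (γ + γ') := by
  simp only [opTwo, Pi.add_apply, add_smul, Finset.sum_add_distrib]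
  rw [add_add_add_comm]
  congr 1
  simp only [← Finset.sum_add_distrib]
  refine Finset.sum_congr rfl fun i _ => Finset.sum_congr rfl fun j _ => ?_
  split_ifs <;> simp [Finset.sum_add_distrib]

theorem opTwo_smul : c • opTwo q x δ β γ = opTwo q x δ (c • β) (c • γ) := by
  simp only [opTwo, Pi.smul_apply, Finset.smul_sum, smul_smul, smul_eq_mul, smul_add, smul_ite,
    smul_zero]

/-- Exchanging the two events leaves `monoTwo` unchanged, so only the symmetric part of `β` matters.
Coefficients of two-event operators therefore need to agree only after symmetrization. -/
theorem opTwo_congr {δ : Fin n → Fin 3 → ℂ} {β β' : Fin n → Dot → Fin n → Dot → ℂ}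
    {γ γ' : Fin n → ℂ} (hγ : ∀ i, γ i = γ' i)
    (hβ : ∀ i j, i ≠ j → ∀ u v, β i u j v + β j v i u = β' i u j v + β' j v i u) :
    opTwo q x δ β γ = opTwo q x δ β' γ' := by
  have key : ∀ β : Fin n → Dot → Fin n → Dot → ℂ,
      (∑ i, ∑ j, if i = j then 0 else ∑ u, ∑ v, β i u j v •
        monoTwo (δ * (spect q x i u * spect q x j v)) i (elemDot u) j (elemDot v)) =
      (1 / 2 : ℂ) • ∑ i, ∑ j, if i = j then 0 else ∑ u, ∑ v, (β i u j v + β j v i u) •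
        monoTwo (δ * (spect q x i u * spect q x j v)) i (elemDot u) j (elemDot v) := by
    intro β
    have h1 : (∑ i, ∑ j, if i = j then 0 else ∑ u, ∑ v, β j v i u •
        monoTwo (δ * (spect q x i u * spect q x j v)) i (elemDot u) j (elemDot v)) =
        ∑ i, ∑ j, if i = j then 0 else ∑ u, ∑ v, β i u j v •
        monoTwo (δ * (spect q x i u * spect q x j v)) i (elemDot u) j (elemDot v) := by
      rw [Finset.sum_comm]
      refine Finset.sum_congr rfl fun i _ => Finset.sum_congr rfl fun j _ => ?_
      by_cases hij : i = j
      · rw [if_pos hij, if_pos hij.symm]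
      · rw [if_neg hij, if_neg (Ne.symm hij), Finset.sum_comm]
        refine Finset.sum_congr rfl fun u _ => Finset.sum_congr rfl fun v _ => ?_
        rw [monoTwo_comm _ _ _ _ _ hij, mul_comm (spect q x i u)]
    have h2 : (∑ i, ∑ j, if i = j then 0 else ∑ u, ∑ v, (β i u j v + β j v i u) •
        monoTwo (δ * (spect q x i u * spect q x j v)) i (elemDot u) j (elemDot v)) =
        (∑ i, ∑ j, if i = j then 0 else ∑ u, ∑ v, β i u j v •
        monoTwo (δ * (spect q x i u * spect q x j v)) i (elemDot u) j (elemDot v)) +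
        ∑ i, ∑ j, if i = j then 0 else ∑ u, ∑ v, β j v i u •
        monoTwo (δ * (spect q x i u * spect q x j v)) i (elemDot u) j (elemDot v) := by
      simp only [← Finset.sum_add_distrib]
      refine Finset.sum_congr rfl fun i _ => Finset.sum_congr rfl fun j _ => ?_
      split_ifs
      · simp
      · simp only [add_smul, Finset.sum_add_distrib]
    rw [h2, h1, ← two_smul ℂ, smul_smul]
    norm_num
  unfold opTwo
  rw [key β, key β', funext hγ]
  congr 2
  refine Finset.sum_congr rfl fun i _ => Finset.sum_congr rfl fun j _ => ?_
  split_ifs with hij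
  · rfl
  · simp only [hβ i j hij]

theorem opDiag_mul_opOne :
    opDiag δ * opOne q x δ' α = opOne q x (δ * δ') fun i u => α i u * δ i u.tgt := by
  simp only [opOne, Finset.mul_sum, mul_smul_comm, opDiag_mul_monoOne, diagonal_mul_elemDot,
    monoOne_smul, smul_smul, mul_assoc]

theorem opOne_mul_opDiag :
    opOne q x δ α * opDiag δ' = opOne q x (δ * δ') fun i u => α i u * δ' i u.src := by
  simp only [opOne, Finset.sum_mul, smul_mul_assoc, monoOne_mul_opDiag, elemDot_mul_diagonal,
    monoOne_smul, smul_smul, mul_right_comm]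

theorem opDiag_mul_opTwo :
    opDiag δ * opTwo q x δ' β γ =
      opTwo q x (δ * δ') (fun i u j v => β i u j v * (δ i u.tgt * δ j v.tgt))
        fun i => γ i * δ i 2 := by
  simp only [opTwo, mul_add, Finset.mul_sum, mul_smul_comm, opDiag_mul_monoOne,
    diagonal_mul_elemBoth, monoOne_smul, smul_smul, mul_assoc]
  congr 1
  refine Finset.sum_congr rfl fun i _ => Finset.sum_congr rfl fun j _ => ?_
  split_ifs with hij
  · simp
  · simp only [Finset.mul_sum, mul_smul_comm, opDiag_mul_monoTwo _ _ _ _ _ _ hij,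
      diagonal_mul_elemDot, monoTwo_smul_right, monoTwo_smul_left _ _ _ _ _ _ hij, smul_smul]

theorem opTwo_mul_opDiag :
    opTwo q x δ β γ * opDiag δ' =
      opTwo q x (δ * δ') (fun i u j v => β i u j v * (δ' i u.src * δ' j v.src))
        fun i => γ i * δ' i 0 := by
  simp only [opTwo, add_mul, Finset.sum_mul, smul_mul_assoc, monoOne_mul_opDiag,
    elemBoth_mul_diagonal, monoOne_smul, smul_smul, mul_right_comm]
  congr 1
  refine Finset.sum_congr rfl fun i _ => Finset.sum_congr rfl fun j _ => ?_
  split_ifs with hij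
  · simp
  · simp only [Finset.sum_mul, smul_mul_assoc, monoTwo_mul_opDiag _ _ _ _ _ _ hij,
      elemDot_mul_diagonal, monoTwo_smul_right, monoTwo_smul_left _ _ _ _ _ _ hij, smul_smul,
      mul_right_comm δ]

/-- For $i\ne j$ each event meets the diagonal factor of the other operator: at $i$ the right factor
acts before the event and sees `src`, at $j$ the left factor acts after the event and sees `tgt`.
For $i=j$ only $\circ$ followed by $\bullet$ survives. -/
theorem opOne_mul_opOne :
    opOne q x δ α * opOne q x δ' α' =
      opTwo q x (δ * δ')
        (fun i u j v => α i u * α' j v *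
          (δ' i u.src * spect q x j v i u.src * (δ j v.tgt * spect q x i u j v.tgt)))
        fun i => α i .bull * α' i .circ := by
  have h : ∀ i j, (∑ u, ∑ v, (α i u * α' j v) •
      (monoOne (δ * spect q x i u) i (elemDot u) * monoOne (δ' * spect q x j v) j (elemDot v))) =
      (if i = j then (α i .bull * α' i .circ) •
        monoOne (δ * δ' * (spect q x i .circ * spect q x i .bull)) i elemBoth else 0) +
      if i = j then 0 else ∑ u, ∑ v, (α i u * α' j v *
          (δ' i u.src * spect q x j v i u.src * (δ j v.tgt * spect q x i u j v.tgt))) •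
        monoTwo (δ * δ' * (spect q x i u * spect q x j v)) i (elemDot u) j (elemDot v) := by
    intro i j
    by_cases hij : i = j
    · subst hij
      rw [if_pos rfl, if_pos rfl, add_zero]
      simp only [monoOne_mul_monoOne_self, elemDot_mul_elemDot, monoOne_smul]
      rw [Finset.sum_eq_single_of_mem Dot.bull (Finset.mem_univ _),
        Finset.sum_eq_single_of_mem Dot.circ (Finset.mem_univ _)]
      · rw [if_pos ⟨rfl, rfl⟩, one_smul, mul_mul_mul_comm,
          mul_comm (spect q x i .bull)]
      · intro v _ hv
        rw [if_neg (fun h => hv h.2), zero_smul, smul_zero]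
      · intro u _ hu
        refine Finset.sum_eq_zero fun v _ => ?_
        rw [if_neg (fun h => hu h.1), zero_smul, smul_zero]
    · rw [if_neg hij, if_neg hij, zero_add]
      refine Finset.sum_congr rfl fun u _ => Finset.sum_congr rfl fun v _ => ?_
      rw [monoOne_mul_monoOne _ _ _ _ _ _ hij, elemDot_mul_diagonal, diagonal_mul_elemDot,
        monoTwo_smul_right, monoTwo_smul_left _ _ _ _ _ _ hij, smul_smul, smul_smul,
        mul_mul_mul_comm δ]
      congr 1
      simp only [Pi.mul_apply]
      ring
  have h2 : opOne q x δ α * opOne q x δ' α' = ∑ i, ∑ j, ∑ u, ∑ v, (α i u * α' j v) •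
      (monoOne (δ * spect q x i u) i (elemDot u) *
        monoOne (δ' * spect q x j v) j (elemDot v)) := by
    unfold opOne
    rw [Finset.sum_mul]
    refine Finset.sum_congr rfl fun i _ => ?_
    rw [Finset.mul_sum]
    refine Finset.sum_congr rfl fun j _ => ?_
    rw [Finset.sum_mul_sum]
    simp only [smul_mul_assoc, mul_smul_comm, smul_smul, mul_comm]
  rw [h2]
  simp only [h, Finset.sum_add_distrib, opTwo]
  congr 1
  refine Finset.sum_congr rfl fun i _ => ?_
  simp

end Ops

/-! ### The twisted column operators as sums over events -/

/-- The diagonal of `d_k(z)`, as a function of `k`. -/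
noncomputable def dDiag (q : ℂ) {n : ℕ} (x : Fin n → ℂ) (z : ℂ) : Fin n → Fin 3 → ℂ :=
  fun k => (d q (x k) z).diag

/-- The scalar in `e_i^u(z)`. -/
noncomputable def eCoeff (q x z : ℂ) : Dot → ℂ
  | .circ => (1 - q ^ 2) * z / (x - q ^ 2 * z)
  | .bull => q * (1 - q) ^ 2 * (1 + q) * (x - z) * z / ((x - q ^ 2 * z) * (x - q ^ 3 * z))

/-- The scalar in `e_i^{•∘}(z)`. -/
noncomputable def eBothCoeff (q x z : ℂ) : ℂ :=
  (1 - q ^ 2) * (x + q ^ 2 * x - q ^ 2 * z - q ^ 3 * z) * z / ((x - q ^ 2 * z) * (x - q ^ 3 * z))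

/-- The scalar in `e_{ij}^{uv}(z)`, after cancellation of the factor `z`. -/
noncomputable def pairWeight (q x y z : ℂ) : Dot → Dot → ℂ
  | .circ, .circ =>
      (x * y + q ^ 2 * x * y - q ^ 2 * x * z - q ^ 2 * y * z) * ((1 - q ^ 2) * z) /
        ((x - q ^ 2 * z) * (y - q ^ 2 * z))
  | .bull, .circ =>
      (x * y + q ^ 2 * x * y - q ^ 2 * x * z - q ^ 3 * y * z) *
        ((1 - q) * (1 + q) * (x - z) * (1 - q ^ 2) * z) /
          ((x - y) * (x - q ^ 2 * z) * (x - q ^ 3 * z) * (y - q ^ 2 * z))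
  | .circ, .bull =>
      (y * x + q ^ 2 * y * x - q ^ 2 * y * z - q ^ 3 * x * z) *
        ((1 - q) * (1 + q) * (y - z) * (1 - q ^ 2) * z) /
          ((y - x) * (y - q ^ 2 * z) * (y - q ^ 3 * z) * (x - q ^ 2 * z))
  | .bull, .bull =>
      (1 + q) * (x * y + q ^ 2 * x * y - q ^ 3 * x * z - q ^ 3 * y * z) *
        (q * (1 - q) ^ 3 * (1 + q) ^ 2 * (x - z) * (y - z) * z) /
        ((x - q * y) * (y - q * x) * (x - q ^ 2 * z) * (x - q ^ 3 * z) * (y - q ^ 2 * z) *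
          (y - q ^ 3 * z))

theorem pairWeight_symm (q x y z : ℂ) (u v : Dot) :
    pairWeight q x y z u v = pairWeight q y x z v u := by
  cases u <;> cases v <;> simp only [pairWeight] <;> ring

/-- The denominator $z$ cancels one of the two factors $z$ of the local events. At $z=0$ both sides
vanish, the left one because of these factors. -/
theorem pairCoeff_mul {q : ℂ} (hq0 : q ≠ 0) (hq1 : 1 - q ≠ 0) (hq2 : 1 + q ≠ 0) (x y z : ℂ)
    (u v : Dot) :
    pairCoeff q x y z u v * (eCoeff q x z u * eCoeff q y z v) = pairWeight q x y z u v := by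
  by_cases hz : z = 0
  · cases u <;> cases v <;> simp [hz, pairWeight, eCoeff]
  · have h : (1 : ℂ) - q ^ 2 ≠ 0 := by
      have : (1 : ℂ) - q ^ 2 = (1 - q) * (1 + q) := by ring
      rw [this]
      exact mul_ne_zero hq1 hq2
    cases u <;> cases v <;> simp only [pairWeight, eCoeff, pairCoeff]
    · rw [div_mul_div_comm, div_mul_div_comm, ← mul_div_mul_left _
        ((x - q ^ 2 * z) * (y - q ^ 2 * z)) (mul_ne_zero h hz)]
      congr 1 <;> ring
    · rw [div_mul_div_comm, div_mul_div_comm, ← mul_div_mul_left _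
        ((y - x) * (y - q ^ 2 * z) * (y - q ^ 3 * z) * (x - q ^ 2 * z))
        (mul_ne_zero (mul_ne_zero hq0 hq1) hz)]
      congr 1 <;> ring
    · rw [div_mul_div_comm, div_mul_div_comm, ← mul_div_mul_left _
        ((x - y) * (x - q ^ 2 * z) * (x - q ^ 3 * z) * (y - q ^ 2 * z))
        (mul_ne_zero (mul_ne_zero hq0 hq1) hz)]
      congr 1 <;> ring
    · rw [div_mul_div_comm, div_mul_div_comm, ← mul_div_mul_left _
        ((x - q * y) * (y - q * x) * (x - q ^ 2 * z) * (x - q ^ 3 * z) * (y - q ^ 2 * z) *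
          (y - q ^ 3 * z))
        (mul_ne_zero (mul_ne_zero hq0 hq1) hz)]
      congr 1 <;> ring

theorem d_eq_diagonal (q x z : ℂ) : d q x z = Matrix.diagonal (d q x z).diag := by
  simp [d]

theorem dDot_eq_diagonal (q x z : ℂ) (u : Dot) :
    dDot q x z u = Matrix.diagonal (dDot q x z u).diag := by
  cases u <;> simp [dDot]

theorem eDot_eq_smul (q x z : ℂ) (u : Dot) : eDot q x z u = eCoeff q x z u • elemDot u := by
  cases u <;> rfl

theorem Gamma0_eq (q : ℂ) {n : ℕ} (x : Fin n → ℂ) (z : ℂ) :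
    Gamma0 q x z = opDiag (dDiag q x z) := by
  unfold Gamma0 opDiag dDiag
  simp only [← d_eq_diagonal]

theorem Gamma1_eq (q : ℂ) {n : ℕ} (x : Fin n → ℂ) (z : ℂ) :
    Gamma1 q x z = opOne q x (dDiag q x z) fun i u => eCoeff q (x i) z u := by
  unfold Gamma1 opOne
  rw [Finset.sum_comm]
  refine Finset.sum_congr rfl fun i _ => Finset.sum_congr rfl fun u _ => ?_
  rw [← monoOne_smul, ← eDot_eq_smul]
  unfold monoOne
  congr 1
  funext k
  by_cases hk : k = i
  · subst hk; simp
  · rw [if_neg hk, Function.update_of_ne hk, d_eq_diagonal, dDot_eq_diagonal,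
      Matrix.diagonal_mul_diagonal]
    rfl

/-- This gives a double event at one site the same product of `spect` factors as a pair of events at
two sites, as the form of `opTwo` demands. -/
theorem dBoth_eq {q x z : ℂ} (hq : 1 + q ≠ 0) (h : q * x - z ≠ 0) :
    dBoth q x z = dDot q x z .circ * dDot q x z .bull := by
  simp only [dBoth, dDot, Matrix.diagonal_mul_diagonal]
  congr 1
  funext a
  fin_cases a
  · simp
  · simp only [Fin.mk_one, Matrix.cons_val_one, Matrix.cons_val_zero]
    rw [div_mul_div_comm, ← mul_div_mul_left (x - q ^ 2 * z) (x - z) (mul_ne_zero hq h)]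
    congr 1 <;> ring
  · simp only [Fin.reduceFinMk, Matrix.cons_val]
    rw [div_mul_div_comm]
    congr 1 <;> ring

theorem Gamma2_eq {q : ℂ} (hq0 : q ≠ 0) (hq1 : 1 - q ≠ 0) (hq2 : 1 + q ≠ 0) {n : ℕ}
    {x : Fin n → ℂ} (hxq : ∀ i j, i ≠ j → x i ≠ q * x j) (z : ℂ) :
    Gamma2 q x z = opTwo q x (dDiag q x z)
      (fun i u j v => 1 / 2 * pairWeight q (x i) (x j) z u v) fun i => eBothCoeff q (x i) z := by
  have h1 : Gamma2 q x z = opTwo q x (dDiag q x z)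
      (fun i u j v => if i < j then pairWeight q (x i) (x j) z u v else 0)
      fun i => eBothCoeff q (x i) z := by
    unfold Gamma2 opTwo
    congr 1
    · refine Finset.sum_congr rfl fun i _ => ?_
      rw [← monoOne_smul]
      unfold monoOne
      congr 1
      funext k
      by_cases hk : k = i
      · subst hk; simp [eBoth, eBothCoeff, elemBoth]
      · rw [if_neg hk, Function.update_of_ne hk, d_eq_diagonal,
          dBoth_eq hq2 (sub_ne_zero.mpr (hxq i k (Ne.symm hk)).symm), dDot_eq_diagonal,
          dDot_eq_diagonal _ _ _ .bull, Matrix.diagonal_mul_diagonal,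
          Matrix.diagonal_mul_diagonal]
        rfl
    · have h2 : ∀ u v : Dot, ∀ i j : Fin n, i < j → (pairCoeff q (x i) (x j) z u v •
          tensor fun k => if k = i then eDot q (x i) z u else if k = j then eDot q (x j) z v
            else d q (x k) z * dDot q (x k) (x i) u * dDot q (x k) (x j) v) =
          pairWeight q (x i) (x j) z u v •
            monoTwo (dDiag q x z * (spect q x i u * spect q x j v)) i (elemDot u) j
              (elemDot v) := by
        intro u v i j hij
        rw [← pairCoeff_mul hq0 hq1 hq2, mul_smul, mul_smul, ← monoTwo_smul_right,
          ← monoTwo_smul_left _ _ _ _ _ _ hij.ne, ← eDot_eq_smul, ← eDot_eq_smul]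
        congr 1
        unfold monoTwo
        congr 1
        funext k
        by_cases hk : k = i
        · subst hk; simp [Function.update_of_ne hij.ne]
        · by_cases hk' : k = j
          · subst hk'; simp [hk]
          · rw [if_neg hk, if_neg hk', Function.update_of_ne hk', Function.update_of_ne hk,
              d_eq_diagonal, dDot_eq_diagonal, dDot_eq_diagonal _ _ _ v,
              Matrix.diagonal_mul_diagonal, Matrix.diagonal_mul_diagonal]
            congr 1
            funext a
            exact mul_assoc _ _ _
      have h3 : ∀ u v : Dot, ∀ i : Fin n, (∑ j ∈ Finset.Ioi i, pairCoeff q (x i) (x j) z u v •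
          tensor fun k => if k = i then eDot q (x i) z u else if k = j then eDot q (x j) z v
            else d q (x k) z * dDot q (x k) (x i) u * dDot q (x k) (x j) v) =
          ∑ j, if i = j then 0 else (if i < j then pairWeight q (x i) (x j) z u v else 0) •
            monoTwo (dDiag q x z * (spect q x i u * spect q x j v)) i (elemDot u) j
              (elemDot v) := by
        intro u v i
        rw [← Finset.filter_lt_eq_Ioi, Finset.sum_filter]
        refine Finset.sum_congr rfl fun j _ => ?_
        by_cases hij : i < j
        · rw [if_pos hij, if_pos hij, if_neg hij.ne, h2 u v i j hij]
        · rw [if_neg hij, if_neg hij, zero_smul, ite_self]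
      simp only [h3]
      rw [Finset.sum_comm]
      simp only [Finset.sum_comm (s := (Finset.univ : Finset Dot))
        (t := (Finset.univ : Finset (Fin n)))]
      refine Finset.sum_congr rfl fun i _ => Finset.sum_congr rfl fun j _ => ?_
      split_ifs
      · simp
      · rw [Finset.sum_comm]
      · rw [Finset.sum_comm]
  rw [h1]
  -- Since `pairWeight_symm` makes the weights symmetric, the sum over $i<j$ is half the sum over
  -- ordered pairs.
  refine opTwo_congr (fun _ => rfl) fun i j hij u v => ?_
  rw [pairWeight_symm q (x j)]
  rcases lt_or_gt_of_ne hij with h | h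
  · rw [if_pos h, if_neg h.not_gt]; ring
  · rw [if_pos h, if_neg h.not_gt]; ring

/-! ### Relations between the twisted column operators -/

/-- The diagonal of `d(∞)`. -/
noncomputable def kap (q : ℂ) : Fin 3 → ℂ := ![1, 1 / q ^ 2, 1 / q ^ 4]

/-- The scalar in `e^u(∞)`. -/
noncomputable def eps (q : ℂ) : Dot → ℂ
  | .circ => -((1 - q) * (1 + q) / q ^ 2)
  | .bull => -((1 - q) ^ 2 * (1 + q) / q ^ 4)

/-- The limit of `Γ_0(z)` as `z → ∞`. -/
noncomputable def opK (q : ℂ) (n : ℕ) : Matrix (Fin n → Fin 3) (Fin n → Fin 3) ℂ :=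
  opDiag fun _ => kap q

/-- The limit of `Γ_1(z)` as `z → ∞`. -/
noncomputable def opE (q : ℂ) {n : ℕ} (x : Fin n → ℂ) :
    Matrix (Fin n → Fin 3) (Fin n → Fin 3) ℂ :=
  opOne q x (fun _ => kap q) fun _ u => eps q u

/-- The diagonals of `d_k^u(w)`, as a function of `k`. -/
noncomputable def dotDiag (q : ℂ) {n : ℕ} (x : Fin n → ℂ) (w : ℂ) (u : Dot) :
    Fin n → Fin 3 → ℂ := fun k => (dDot q (x k) w u).diag

/-- The diagonals of `d_k^∘(w) d_k(w)`, as a function of `k`. -/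
noncomputable def midDiag (q : ℂ) {n : ℕ} (x : Fin n → ℂ) (w : ℂ) : Fin n → Fin 3 → ℂ :=
  fun k => ![1, (q * x k - w) / (1 + q), (x k - w) / (x k - q ^ 2 * w)]

/-- The coefficients of the single events in the middle block of the intertwiner. -/
noncomputable def midCoeff (q w x : ℂ) : Dot → ℂ
  | .circ => w
  | .bull => (1 - q) * (1 + q) * w / (x - q ^ 2 * w)

/-- The middle block of the intertwiner that raises the state by one unit. -/
noncomputable def opMid (q : ℂ) {n : ℕ} (x : Fin n → ℂ) (w : ℂ) :
    Matrix (Fin n → Fin 3) (Fin n → Fin 3) ℂ :=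
  opOne q x (midDiag q x w) fun i u => midCoeff q w (x i) u

/-- The diagonal block of `opE` for one more site, with parameter `w` and in the state `a`. -/
noncomputable def opEBlock (q : ℂ) {n : ℕ} (x : Fin n → ℂ) (w : ℂ) (a : Fin 3) :
    Matrix (Fin n → Fin 3) (Fin n → Fin 3) ℂ :=
  opOne q x (fun _ => kap q) fun i u => eps q u * (kap q a * (dDot q w (x i) u).diag a)

section Relations

variable {q : ℂ} (hq0 : q ≠ 0) (hq1 : 1 - q ≠ 0) (hq2 : 1 + q ≠ 0) {n : ℕ} {x : Fin n → ℂ}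

theorem opK_mul_Gamma0 (z : ℂ) : opK q n * Gamma0 q x z = Gamma0 q x z * opK q n := by
  rw [Gamma0_eq, opK, opDiag_mul_opDiag, opDiag_mul_opDiag, mul_comm]

include hq0 in
theorem kap_tgt (u : Dot) : kap q u.tgt = 1 / q ^ 2 * kap q u.src := by
  cases u <;> simp [kap, Dot.src, Dot.tgt]
  field_simp

include hq0 in
theorem opK_mul_Gamma1 (z : ℂ) :
    opK q n * Gamma1 q x z = (1 / q ^ 2) • (Gamma1 q x z * opK q n) := by
  rw [Gamma1_eq, opK, opDiag_mul_opOne, opOne_mul_opDiag, opOne_smul, mul_comm (dDiag q x z)]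
  congr 1
  funext i u
  simp only [kap_tgt hq0, Pi.smul_apply, smul_eq_mul]
  ring

include hq0 hq1 hq2 in
theorem opK_mul_Gamma2 (hxq : ∀ i j, i ≠ j → x i ≠ q * x j) (z : ℂ) :
    opK q n * Gamma2 q x z = (1 / q ^ 4) • (Gamma2 q x z * opK q n) := by
  rw [Gamma2_eq hq0 hq1 hq2 hxq, opK, opDiag_mul_opTwo, opTwo_mul_opDiag, opTwo_smul,
    mul_comm (dDiag q x z)]
  congr 1
  · funext i u j v
    simp only [kap_tgt hq0, Pi.smul_apply, smul_eq_mul]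
    ring
  · funext i
    simp [kap, Pi.smul_apply, smul_eq_mul]
    ring

include hq0 in
-- All terms are single-event sums with the same diagonal factors, so one scalar identity per dot
-- suffices. As $K$ is invertible, the relation recovers $\Gamma_1$ from $\Gamma_0$, $E$ and $K$.
theorem opE_mul_Gamma0 {z : ℂ} (hz2 : ∀ i, x i - q ^ 2 * z ≠ 0) (hz3 : ∀ i, x i - q ^ 3 * z ≠ 0) :
    opE q x * Gamma0 q x z = Gamma0 q x z * opE q x + eps q .circ • (Gamma1 q x z * opK q n) := by
  rw [Gamma0_eq, Gamma1_eq, opK, opE, opDiag_mul_opOne, opOne_mul_opDiag, opOne_mul_opDiag,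
    opOne_smul, opOne_add, mul_comm (dDiag q x z)]
  congr 1
  funext i u
  have h2 := hz2 i
  have h3 := hz3 i
  cases u <;>
    simp only [Pi.add_apply, Pi.smul_apply, smul_eq_mul, eps, eCoeff, kap, dDiag, d, Dot.src,
      Dot.tgt, Matrix.diag_diagonal, Matrix.cons_val]
  · field_simp
    ring
  · field_simp
    ring

include hq0 hq1 hq2 in
-- Every term has two events, so there remain one scalar identity for a double event at a site and,
-- after symmetrization, one for each pair of dots at two sites. The relation recovers $\Gamma_2$
-- from $\Gamma_1$, $E$ and $K$.
theorem opE_mul_Gamma1 (hx : ∀ i j, i ≠ j → x i ≠ x j) (hxq : ∀ i j, i ≠ j → x i ≠ q * x j)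
    {z : ℂ} (hz2 : ∀ i, x i - q ^ 2 * z ≠ 0) (hz3 : ∀ i, x i - q ^ 3 * z ≠ 0) :
    opE q x * Gamma1 q x z =
      (-1 / q) • (Gamma1 q x z * opE q x) + eps q .bull • (Gamma2 q x z * opK q n) := by
  rw [Gamma1_eq, Gamma2_eq hq0 hq1 hq2 hxq, opK, opE, opOne_mul_opOne, opOne_mul_opOne,
    opTwo_mul_opDiag, opTwo_smul, opTwo_smul, mul_comm (dDiag q x z), opTwo_add]
  refine opTwo_congr (fun i => ?_) fun i j hij u v => ?_
  · have h2 := hz2 i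
    have h3 := hz3 i
    simp only [Pi.add_apply, Pi.smul_apply, smul_eq_mul, eps, eCoeff, eBothCoeff, kap,
      Matrix.cons_val]
    field_simp
    ring
  · have h2 := hz2 i
    have h3 := hz3 i
    have h2' := hz2 j
    have h3' := hz3 j
    have k1 := sub_ne_zero.mpr (hx i j hij)
    have k1' := sub_ne_zero.mpr (hx j i hij.symm)
    have k2 := sub_ne_zero.mpr (hxq i j hij)
    have k2' := sub_ne_zero.mpr (hxq j i hij.symm)
    have k3 := sub_ne_zero.mpr (hxq i j hij).symm
    have k3' := sub_ne_zero.mpr (hxq j i hij.symm).symm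
    cases u <;> cases v <;>
      simp only [Pi.add_apply, Pi.smul_apply, smul_eq_mul, eps, eCoeff, kap, dDiag, d, Dot.src,
        Dot.tgt, spect, dDot, pairWeight, Matrix.diag_diagonal, Matrix.cons_val] <;>
      generalize x i = y at * <;> generalize x j = y' at *
    · field_simp
      ring
    · field_simp
      ring
    · field_simp
      ring
    · field_simp
      ring

/-- This is the $(0,1)$ entry of the intertwining relation for $\Gamma_0$; `Gamma0_mul_Gamma2` and
`mid_mul_Gamma0` are its $(0,2)$ and $(1,2)$ entries. -/
theorem Gamma0_mul_Gamma1 {w z : ℂ} (hwz2 : w - q ^ 2 * z ≠ 0)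
    (hz2 : ∀ i, x i - q ^ 2 * z ≠ 0) (hz3 : ∀ i, x i - q ^ 3 * z ≠ 0)
    (hw2 : ∀ i, x i - q ^ 2 * w ≠ 0) (hw3 : ∀ i, x i - q ^ 3 * w ≠ 0) :
    weight q w z 1 0 0 1 • (Gamma0 q x w * Gamma1 q x z) +
      weight q w z 0 1 0 1 • (Gamma1 q x w * Gamma0 q x z) = Gamma0 q x z * Gamma1 q x w := by
  rw [Gamma0_eq, Gamma1_eq, Gamma0_eq, Gamma1_eq, opDiag_mul_opOne, opOne_mul_opDiag,
    opDiag_mul_opOne, opOne_smul, opOne_smul, opOne_add, mul_comm (dDiag q x z)]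
  congr 1
  funext i u
  have h2 := hz2 i
  have h3 := hz3 i
  have h4 := hw2 i
  have h5 := hw3 i
  cases u <;>
    simp only [Pi.add_apply, Pi.smul_apply, smul_eq_mul, weight, eCoeff, dDiag, d, Dot.src,
      Dot.tgt, Matrix.diag_diagonal, Matrix.cons_val]
  · field_simp
    ring
  · field_simp
    ring

include hq0 hq1 hq2 in
theorem Gamma0_mul_Gamma2 (hx : ∀ i j, i ≠ j → x i ≠ x j) (hxq : ∀ i j, i ≠ j → x i ≠ q * x j)
    {w z : ℂ} (hwz2 : w - q ^ 2 * z ≠ 0) (hwz3 : w - q ^ 3 * z ≠ 0)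
    (hz2 : ∀ i, x i - q ^ 2 * z ≠ 0) (hz3 : ∀ i, x i - q ^ 3 * z ≠ 0)
    (hw2 : ∀ i, x i - q ^ 2 * w ≠ 0) (hw3 : ∀ i, x i - q ^ 3 * w ≠ 0) :
    weight q w z 2 0 0 2 • (Gamma0 q x w * Gamma2 q x z) +
        weight q w z 1 1 0 2 • (Gamma1 q x w * Gamma1 q x z) +
        weight q w z 0 2 0 2 • (Gamma2 q x w * Gamma0 q x z) =
      Gamma0 q x z * Gamma2 q x w := by
  rw [Gamma0_eq, Gamma1_eq, Gamma0_eq, Gamma1_eq, Gamma2_eq hq0 hq1 hq2 hxq,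
    Gamma2_eq hq0 hq1 hq2 hxq, opDiag_mul_opTwo, opTwo_mul_opDiag, opOne_mul_opOne,
    opDiag_mul_opTwo, opTwo_smul, opTwo_smul, opTwo_smul, opTwo_add, opTwo_add,
    mul_comm (dDiag q x z)]
  refine opTwo_congr (fun i => ?_) fun i j hij u v => ?_
  · have h2 := hz2 i
    have h3 := hz3 i
    have h4 := hw2 i
    have h5 := hw3 i
    simp only [Pi.add_apply, Pi.smul_apply, smul_eq_mul, eCoeff, eBothCoeff, weight, dDiag, d,
      Matrix.diag_diagonal, Matrix.cons_val]
    generalize x i = y at *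
    field_simp
    ring
  · have h2 := hz2 i
    have h3 := hz3 i
    have h2' := hz2 j
    have h3' := hz3 j
    have h4 := hw2 i
    have h5 := hw3 i
    have h4' := hw2 j
    have h5' := hw3 j
    have k1 := sub_ne_zero.mpr (hx i j hij)
    have k1' := sub_ne_zero.mpr (hx j i hij.symm)
    have k2 := sub_ne_zero.mpr (hxq i j hij)
    have k2' := sub_ne_zero.mpr (hxq j i hij.symm)
    have k3 := sub_ne_zero.mpr (hxq i j hij).symm
    have k3' := sub_ne_zero.mpr (hxq j i hij.symm).symm
    cases u <;> cases v <;>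
      simp only [Pi.add_apply, Pi.smul_apply, smul_eq_mul, eCoeff, dDiag, d, Dot.src, weight,
        Dot.tgt, spect, dDot, pairWeight, Matrix.diag_diagonal, Matrix.cons_val] <;>
      generalize x i = y at * <;> generalize x j = y' at *
    · field_simp
      ring
    · field_simp
      ring
    · field_simp
      ring
    · field_simp
      ring

/-- The $(1,0)$ and $(2,1)$ entries of the relation for $E$ ask that `midDiag` equal
$d^\circ(w)d(w)$ and be the inverse of $d^\bullet(w)$. The two demands agree because
$d^\circ(w)d^\bullet(w)=d^{\bullet\circ}(w)=d(w)^{-1}$. -/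
theorem midDiag_eq (hq2 : 1 + q ≠ 0) {w : ℂ} (hw0 : ∀ i, x i - w ≠ 0)
    (hw1 : ∀ i, x i - q * w ≠ 0) (hw2 : ∀ i, x i - q ^ 2 * w ≠ 0)
    (hw3 : ∀ i, x i - q ^ 3 * w ≠ 0) :
    midDiag q x w = dotDiag q x w .circ * dDiag q x w := by
  funext i a
  have h2 := hw0 i
  have h3 := hw1 i
  have h4 := hw2 i
  have h5 := hw3 i
  have h3' : x i - w * q ≠ 0 := by rwa [mul_comm w]
  have h4' : x i - w * q ^ 2 ≠ 0 := by rwa [mul_comm w]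
  have h5' : x i - w * q ^ 3 ≠ 0 := by rwa [mul_comm w]
  fin_cases a <;> simp [midDiag, dotDiag, dDiag, d, dDot]
  · field_simp
  · field_simp

theorem midDiag_mul (hq2 : 1 + q ≠ 0) {w : ℂ} (hw0 : ∀ i, x i - w ≠ 0)
    (hw1' : ∀ i, q * x i - w ≠ 0) (hw2 : ∀ i, x i - q ^ 2 * w ≠ 0) :
    dotDiag q x w .bull * midDiag q x w = 1 := by
  funext i a
  have h2 := hw0 i
  have h3 := hw1' i
  have h4 := hw2 i
  fin_cases a <;> simp [midDiag, dotDiag, dDot]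
  · field_simp
  · field_simp

include hq2 in
theorem mid_mul_Gamma0 {w z : ℂ} (hwz2 : w - q ^ 2 * z ≠ 0) (hwz3 : w - q ^ 3 * z ≠ 0)
    (hz2 : ∀ i, x i - q ^ 2 * z ≠ 0) (hz3 : ∀ i, x i - q ^ 3 * z ≠ 0)
    (hw2 : ∀ i, x i - q ^ 2 * w ≠ 0) :
    weight q w z 1 1 0 2 • (opDiag (midDiag q x w) * Gamma1 q x z) +
      weight q w z 0 2 0 2 • (opMid q x w * Gamma0 q x z) =
    ((w - z) / (w - q ^ 2 * z)) • (Gamma0 q x z * opMid q x w) := by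
  rw [Gamma0_eq, Gamma1_eq, opMid, opDiag_mul_opOne, opOne_mul_opDiag, opDiag_mul_opOne,
    opOne_smul, opOne_smul, opOne_smul, opOne_add, mul_comm (dDiag q x z)]
  congr 1
  funext i u
  have h2 := hz2 i
  have h3 := hz3 i
  have h4 := hw2 i
  cases u <;>
    simp only [Pi.add_apply, Pi.smul_apply, smul_eq_mul, weight, eCoeff, dDiag, d, Dot.src,
      Dot.tgt, midDiag, midCoeff, Matrix.diag_diagonal, Matrix.cons_val]
  · field_simp
    ring
  · field_simp
    ring

include hq0 hq1 hq2 in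
-- This is the $(1,1)$ entry of the intertwining relation for $E$; `opMid_mul_opE` is the $(1,2)$
-- entry.
theorem mid_mul_opE {w : ℂ} (hw0 : ∀ i, x i - w ≠ 0)
    (hw1 : ∀ i, x i - q * w ≠ 0) (hw1' : ∀ i, q * x i - w ≠ 0) (hw2 : ∀ i, x i - q ^ 2 * w ≠ 0)
    (hw3 : ∀ i, x i - q ^ 3 * w ≠ 0) :
    (-1 / q) • (opDiag (midDiag q x w) * opE q x) + eps q .bull • (opMid q x w * opK q n) =
      eps q .circ • (opK q n * opDiag (dotDiag q x w .circ) * Gamma1 q x w) +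
        opEBlock q x w 1 * opDiag (midDiag q x w) := by
  rw [Gamma1_eq, opMid, opK, opE, opEBlock, opDiag_mul_opOne, opOne_mul_opDiag,
    opDiag_mul_opDiag, opDiag_mul_opOne, opOne_mul_opDiag, opOne_smul, opOne_smul, opOne_smul,
    mul_assoc, ← midDiag_eq hq2 hw0 hw1 hw2 hw3, mul_comm (midDiag q x w), opOne_add, opOne_add]
  congr 1
  funext i u
  have h2 := hw0 i
  have h3 := hw1 i
  have h3' := hw1' i
  have h4 := hw2 i
  have h5 := hw3 i
  have k0 : w - x i ≠ 0 := by rw [← neg_sub]; exact neg_ne_zero.mpr h2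
  have k2 : w - q * x i ≠ 0 := by rw [← neg_sub]; exact neg_ne_zero.mpr h3'
  have k1 : q * w - x i ≠ 0 := by rw [← neg_sub]; exact neg_ne_zero.mpr h3
  cases u <;>
    simp only [Pi.add_apply, Pi.smul_apply, Pi.mul_apply, smul_eq_mul, eps, kap, dotDiag, dDot,
      eCoeff, Dot.src, Dot.tgt, midDiag, midCoeff, Matrix.diag_diagonal, Matrix.cons_val]
  · field_simp
    ring
  · field_simp
    ring

include hq0 hq1 hq2 in
theorem opMid_mul_opE (hx : ∀ i j, i ≠ j → x i ≠ x j) (hxq : ∀ i j, i ≠ j → x i ≠ q * x j)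
    {w : ℂ} (hw0 : ∀ i, x i - w ≠ 0)
    (hw1 : ∀ i, x i - q * w ≠ 0) (hw1' : ∀ i, q * x i - w ≠ 0) (hw2 : ∀ i, x i - q ^ 2 * w ≠ 0)
    (hw3 : ∀ i, x i - q ^ 3 * w ≠ 0) :
    (1 / q ^ 2) • (opMid q x w * opE q x) =
      eps q .circ • (opK q n * opDiag (dotDiag q x w .circ) * Gamma2 q x w) +
        opEBlock q x w 1 * opMid q x w := by
  rw [Gamma2_eq hq0 hq1 hq2 hxq, opMid, opK, opE, opEBlock, opDiag_mul_opDiag, opDiag_mul_opTwo,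
    opOne_mul_opOne, opOne_mul_opOne, opTwo_smul, opTwo_smul,
    mul_assoc, ← midDiag_eq hq2 hw0 hw1 hw2 hw3, mul_comm (midDiag q x w), opTwo_add]
  refine opTwo_congr (fun i => ?_) fun i j hij u v => ?_
  · have h2 := hw0 i
    have h3 := hw1 i
    have h3' := hw1' i
    have h4 := hw2 i
    have h5 := hw3 i
    have k0 : w - x i ≠ 0 := by rw [← neg_sub]; exact neg_ne_zero.mpr h2
    have k2 : w - q * x i ≠ 0 := by rw [← neg_sub]; exact neg_ne_zero.mpr h3'
    have k1 : q * w - x i ≠ 0 := by rw [← neg_sub]; exact neg_ne_zero.mpr h3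
    simp only [Pi.add_apply, Pi.smul_apply, Pi.mul_apply, smul_eq_mul, eBothCoeff, eps, kap,
      dotDiag, dDot, midCoeff, Matrix.diag_diagonal, Matrix.cons_val]
    generalize x i = y at *
    field_simp
    ring
  · have h2 := hw0 i
    have h3 := hw1 i
    have h3' := hw1' i
    have h4 := hw2 i
    have h5 := hw3 i
    have l0 : w - x i ≠ 0 := by rw [← neg_sub]; exact neg_ne_zero.mpr h2
    have l2 : w - q * x i ≠ 0 := by rw [← neg_sub]; exact neg_ne_zero.mpr h3'
    have l1 : q * w - x i ≠ 0 := by rw [← neg_sub]; exact neg_ne_zero.mpr h3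
    have m2 := hw0 j
    have m3 := hw1 j
    have m3' := hw1' j
    have m4 := hw2 j
    have m5 := hw3 j
    have n0 : w - x j ≠ 0 := by rw [← neg_sub]; exact neg_ne_zero.mpr m2
    have n2 : w - q * x j ≠ 0 := by rw [← neg_sub]; exact neg_ne_zero.mpr m3'
    have n1 : q * w - x j ≠ 0 := by rw [← neg_sub]; exact neg_ne_zero.mpr m3
    have k1 := sub_ne_zero.mpr (hx i j hij)
    have k1' := sub_ne_zero.mpr (hx j i hij.symm)
    have k2 := sub_ne_zero.mpr (hxq i j hij)
    have k2' := sub_ne_zero.mpr (hxq j i hij.symm)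
    have k3 := sub_ne_zero.mpr (hxq i j hij).symm
    have k3' := sub_ne_zero.mpr (hxq j i hij.symm).symm
    cases u <;> cases v <;>
      simp only [Pi.add_apply, Pi.smul_apply, Pi.mul_apply, smul_eq_mul, eps, kap, dotDiag,
        Dot.src, Dot.tgt, midDiag, midCoeff, spect, dDot, pairWeight, Matrix.diag_diagonal,
        Matrix.cons_val] <;>
      generalize x i = y at * <;> generalize x j = y' at *
    · field_simp
      ring
    · field_simp
      ring
    · field_simp
      ring
    · field_simp
      ring

include hq0 hq1 hq2 in
-- This is the $(2,2)$ entry of the relation for $E$. The operator in front of `opMid` is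
-- invertible, so this entry determines `opMid` and is a source for the values of `midCoeff`.
theorem opE_eq_block {w : ℂ} (hw0 : ∀ i, x i - w ≠ 0)
    (hw1' : ∀ i, q * x i - w ≠ 0) (hw2 : ∀ i, x i - q ^ 2 * w ≠ 0) :
    (1 / q ^ 2) • opE q x =
      eps q .bull • (opK q n * opDiag (dotDiag q x w .bull) * opMid q x w) +
        opEBlock q x w 2 := by
  rw [opMid, opK, opE, opEBlock, opDiag_mul_opDiag, opDiag_mul_opOne, opOne_smul, opOne_smul,
    mul_assoc, midDiag_mul hq2 hw0 hw1' hw2, mul_one, opOne_add]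
  congr 1
  funext i u
  have h2 := hw0 i
  have h3' := hw1' i
  have h4 := hw2 i
  have k0 : w - x i ≠ 0 := by rw [← neg_sub]; exact neg_ne_zero.mpr h2
  have k2 : w - q * x i ≠ 0 := by rw [← neg_sub]; exact neg_ne_zero.mpr h3'
  cases u <;>
    simp only [Pi.add_apply, Pi.smul_apply, Pi.mul_apply, smul_eq_mul, eps, kap, dotDiag, dDot,
      Dot.tgt, midCoeff, Matrix.diag_diagonal, Matrix.cons_val]
  · field_simp
    ring
  · field_simp
    ring

end Relations

/-! ### Block matrices over the last site -/

/-- The matrix on `n + 1` sites as a `3 × 3` matrix of operators on the first `n` sites. -/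
def blk {n : ℕ} (A : Matrix (Fin (n + 1) → Fin 3) (Fin (n + 1) → Fin 3) ℂ) :
    Matrix (Fin 3) (Fin 3) (Matrix (Fin n → Fin 3) (Fin n → Fin 3) ℂ) :=
  Matrix.of fun a c => Matrix.of fun s t => A (Fin.snoc (α := fun _ => Fin 3) s a)
    (Fin.snoc (α := fun _ => Fin 3) t c)

theorem blk_one (n : ℕ) :
    blk (1 : Matrix (Fin (n + 1) → Fin 3) (Fin (n + 1) → Fin 3) ℂ) = 1 := by
  ext a c s t
  simp only [blk, Matrix.of_apply, Matrix.one_apply, Fin.snoc_inj]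
  by_cases h : a = c <;> by_cases h' : s = t <;> simp [h, h', Matrix.one_apply]

theorem blk_mul {n : ℕ} (A B : Matrix (Fin (n + 1) → Fin 3) (Fin (n + 1) → Fin 3) ℂ) :
    blk (A * B) = blk A * blk B := by
  ext a c s t
  simp only [blk, Matrix.mul_apply, Matrix.of_apply, Matrix.sum_apply]
  rw [← (Fin.snocEquiv (fun _ : Fin (n + 1) => Fin 3)).sum_comp, Fintype.sum_prod_type]
  rfl

theorem blk_add {n : ℕ} (A B : Matrix (Fin (n + 1) → Fin 3) (Fin (n + 1) → Fin 3) ℂ) :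
    blk (A + B) = blk A + blk B := rfl

theorem blk_smul {n : ℕ} (c : ℂ) (A : Matrix (Fin (n + 1) → Fin 3) (Fin (n + 1) → Fin 3) ℂ) :
    blk (c • A) = c • blk A := rfl

theorem blk_injective {n : ℕ} : Function.Injective (blk (n := n)) := by
  intro A B h
  ext s t
  have := congrFun (congrFun (congrFun (congrFun h (s (Fin.last n))) (t (Fin.last n)))
    (Fin.init s)) (Fin.init t)
  simpa [blk] using this

theorem blk_sum {n : ℕ} {ι : Type*} (s : Finset ι)
    (A : ι → Matrix (Fin (n + 1) → Fin 3) (Fin (n + 1) → Fin 3) ℂ) :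
    blk (∑ i ∈ s, A i) = ∑ i ∈ s, blk (A i) := by
  ext a c r t
  simp [blk, Matrix.sum_apply]

theorem blk_tensor {n : ℕ} (A : Fin (n + 1) → Matrix (Fin 3) (Fin 3) ℂ) (a c : Fin 3) :
    blk (tensor A) a c = A (Fin.last n) a c • tensor fun i => A i.castSucc := by
  ext s t
  simp [blk, tensor, Fin.prod_univ_castSucc, mul_comm]

theorem blk_opDiag {n : ℕ} (δ : Fin (n + 1) → Fin 3 → ℂ) (a c : Fin 3) :
    blk (opDiag δ) a c = if a = c then δ (Fin.last n) a • opDiag (fun i => δ i.castSucc) else 0 := by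
  unfold opDiag
  rw [blk_tensor, Matrix.diagonal_apply]
  split_ifs <;> simp

theorem blk_monoOne_castSucc {n : ℕ} (δ : Fin (n + 1) → Fin 3 → ℂ) (i : Fin n)
    (A : Matrix (Fin 3) (Fin 3) ℂ) (a c : Fin 3) :
    blk (monoOne δ i.castSucc A) a c =
      if a = c then δ (Fin.last n) a • monoOne (fun i => δ i.castSucc) i A else 0 := by
  unfold monoOne
  rw [blk_tensor, Function.update_of_ne (Fin.castSucc_lt_last i).ne', Matrix.diagonal_apply]
  have h : (fun k : Fin n => Function.update (fun k => Matrix.diagonal (δ k)) i.castSucc A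
      k.castSucc) = Function.update (fun k => Matrix.diagonal (δ k.castSucc)) i A := by
    funext k
    by_cases hk : k = i
    · subst hk; simp
    · rw [Function.update_of_ne hk,
        Function.update_of_ne (fun h => hk (Fin.castSucc_injective _ h))]
  rw [h]
  split_ifs <;> simp

theorem blk_monoOne_last {n : ℕ} (δ : Fin (n + 1) → Fin 3 → ℂ)
    (A : Matrix (Fin 3) (Fin 3) ℂ) (a c : Fin 3) :
    blk (monoOne δ (Fin.last n) A) a c = A a c • opDiag (fun i => δ i.castSucc) := by
  unfold monoOne opDiag
  rw [blk_tensor, Function.update_self]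
  congr 2
  funext k
  rw [Function.update_of_ne (Fin.castSucc_lt_last k).ne]

theorem blk_Gamma0 (q : ℂ) {n : ℕ} (x : Fin (n + 1) → ℂ) (z : ℂ) (a c : Fin 3) :
    blk (Gamma0 q x z) a c = if a = c then
      (d q (x (Fin.last n)) z).diag a • Gamma0 q (fun i => x i.castSucc) z else 0 := by
  rw [Gamma0_eq, blk_opDiag, Gamma0_eq]
  rfl

theorem blk_opK (q : ℂ) (n : ℕ) : blk (opK q (n + 1)) =
    Matrix.diagonal fun a => kap q a • opK q n := by
  ext a c : 1
  rw [opK, blk_opDiag, Matrix.diagonal_apply]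
  rfl

/-- Events at earlier sites see the last site only through a diagonal factor and give diagonal
blocks. Events at the last site give the blocks below the diagonal. -/
theorem blk_opE (q : ℂ) {n : ℕ} (x : Fin (n + 1) → ℂ) (a c : Fin 3) :
    blk (opE q x) a c = (if a = c then
      opEBlock q (fun i => x i.castSucc) (x (Fin.last n)) a else 0) +
      ∑ u, (eps q u * elemDot u a c) • (opK q n *
        opDiag (dotDiag q (fun i => x i.castSucc) (x (Fin.last n)) u)) := by
  rw [opE, opOne, Fin.sum_univ_castSucc, blk_add, blk_sum, blk_sum]
  simp only [blk_sum, blk_smul, Matrix.add_apply, Matrix.sum_apply, Matrix.smul_apply,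
    blk_monoOne_castSucc, blk_monoOne_last]
  congr 1
  · split_ifs
    · unfold opEBlock opOne
      refine Finset.sum_congr rfl fun i _ => Finset.sum_congr rfl fun u _ => ?_
      rw [smul_smul]
      rfl
    · simp
  · refine Finset.sum_congr rfl fun u _ => ?_
    rw [smul_smul, opK, opDiag_mul_opDiag]
    rfl

theorem opEBlock_zero (q : ℂ) {n : ℕ} (x : Fin n → ℂ) (w : ℂ) : opEBlock q x w 0 = opE q x := by
  unfold opEBlock opE
  congr 1
  funext i u
  cases u <;> simp [kap, dDot]

/-! ### Adding a row -/

/-- The exchange relations of the column operators `X 0, X 1, X 2` with `E` and `K`. -/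
structure ColumnRelations (q : ℂ) {R : Type*} [Ring R] [Algebra ℂ R] (X : Fin 3 → R)
    (E K : R) : Prop where
  K_mul_zero : K * X 0 = X 0 * K
  K_mul_one : K * X 1 = (1 / q ^ 2) • (X 1 * K)
  K_mul_two : K * X 2 = (1 / q ^ 4) • (X 2 * K)
  E_mul_zero : E * X 0 = X 0 * E + eps q .circ • (X 1 * K)
  E_mul_one : E * X 1 = (-1 / q) • (X 1 * E) + eps q .bull • (X 2 * K)
  E_mul_two : E * X 2 = (1 / q ^ 2) • (X 2 * E)

section Blocks

variable {R : Type*} [Ring R] [Algebra ℂ R]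

/-- The column operator with top state `k` after a row with parameter `w` is added on top of the
rows with column operators `X 0, X 1, X 2`. -/
noncomputable def addRow (q w z : ℂ) (X : Fin 3 → R) (k : Fin 3) : Matrix (Fin 3) (Fin 3) R :=
  Matrix.of fun a b => ∑ j, weight q w z j a k b • X j

/-- The operator `E` after a row is added. -/
noncomputable def addRowE (q : ℂ) (E K : R) : Matrix (Fin 3) (Fin 3) R :=
  !![E, 0, 0; eps q .circ • K, (-1 / q) • E, 0; 0, eps q .bull • K, (1 / q ^ 2) • E]

/-- The operator `K` after a row is added. -/
noncomputable def addRowK (q : ℂ) (K : R) : Matrix (Fin 3) (Fin 3) R :=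
  Matrix.diagonal fun a => kap q a • K

variable {q w z : ℂ} {X : Fin 3 → R} {E K : R}

/-- Conservation of the states at a vertex; it is what makes the block matrices `addRow` banded. -/
theorem weight_eq_zero (q x y : ℂ) {i j k l : Fin 3} (h : (i : ℕ) + j ≠ k + l) :
    weight q x y i j k l = 0 := by
  unfold weight
  split <;> first | rfl | exact absurd rfl h

theorem weight_corner (q x y : ℂ) :
    weight q x y 0 0 0 0 = 1 ∧ weight q x y 2 2 2 2 = 1 := ⟨rfl, rfl⟩

theorem addRow_zero : addRow q w z X 0 =
    !![X 0, weight q w z 1 0 0 1 • X 1, weight q w z 2 0 0 2 • X 2;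
      0, weight q w z 0 1 0 1 • X 0, weight q w z 1 1 0 2 • X 1;
      0, 0, weight q w z 0 2 0 2 • X 0] := by
  ext a c : 2
  fin_cases a <;> fin_cases c <;> simp [addRow, Fin.sum_univ_three, weight_eq_zero, weight_corner]

theorem addRow_one : addRow q w z X 1 =
    !![weight q w z 1 0 1 0 • X 1, weight q w z 2 0 1 1 • X 2, 0;
      weight q w z 0 1 1 0 • X 0, weight q w z 1 1 1 1 • X 1, weight q w z 2 1 1 2 • X 2;
      0, weight q w z 0 2 1 1 • X 0, weight q w z 1 2 1 2 • X 1] := by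
  ext a c : 2
  fin_cases a <;> fin_cases c <;> simp [addRow, Fin.sum_univ_three, weight_eq_zero]

theorem addRow_two : addRow q w z X 2 =
    !![weight q w z 2 0 2 0 • X 2, 0, 0;
      weight q w z 1 1 2 0 • X 1, weight q w z 2 1 2 1 • X 2, 0;
      weight q w z 0 2 2 0 • X 0, weight q w z 1 2 2 1 • X 1, X 2] := by
  ext a c : 2
  fin_cases a <;> fin_cases c <;> simp [addRow, Fin.sum_univ_three, weight_eq_zero, weight_corner]

theorem addRowK_eq : addRowK q K =
    !![K, 0, 0; 0, (1 / q ^ 2) • K, 0; 0, 0, (1 / q ^ 4) • K] := by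
  ext a c : 2
  fin_cases a <;> fin_cases c <;> simp [addRowK, kap]

set_option maxHeartbeats 1000000 in
-- The relations in `h` serve as rewriting rules that move $E$ and $K$ to the right of the $X_j$.
-- Each block entry becomes a linear combination of the products $X_jE$ and $X_jK$, and comparing
-- coefficients leaves rational identities for the vertex weights.
theorem addRowE_mul_zero (hq0 : q ≠ 0) (h2 : w - q ^ 2 * z ≠ 0) (h3 : w - q ^ 3 * z ≠ 0)
    (h : ColumnRelations q X E K) :
    addRowE q E K * addRow q w z X 0 =
      addRow q w z X 0 * addRowE q E K + eps q .circ • (addRow q w z X 1 * addRowK q K) := by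
  have h2' : w - z * q ^ 2 ≠ 0 := by rwa [mul_comm z]
  have h3' : w - z * q ^ 3 ≠ 0 := by rwa [mul_comm z]
  rw [addRow_zero, addRow_one, addRowK_eq, addRowE]
  ext a c : 2
  fin_cases a <;> fin_cases c <;>
    simp only [Matrix.add_apply, Matrix.smul_apply, Matrix.mul_apply, Fin.sum_univ_three,
      Matrix.of_apply, Matrix.cons_val, Fin.mk_one, Fin.zero_eta, Fin.reduceFinMk,
      zero_mul, mul_zero, add_zero, zero_add, smul_zero, smul_mul_assoc,
      mul_smul_comm, h.K_mul_zero, h.K_mul_one, h.K_mul_two, h.E_mul_zero, h.E_mul_one,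
      h.E_mul_two]
  all_goals match_scalars <;> simp only [weight, eps] <;> field_simp <;> ring

set_option maxHeartbeats 1000000 in
theorem addRowE_mul_one (hq0 : q ≠ 0) (h2 : w - q ^ 2 * z ≠ 0) (h3 : w - q ^ 3 * z ≠ 0)
    (h : ColumnRelations q X E K) :
    addRowE q E K * addRow q w z X 1 =
      (-1 / q) • (addRow q w z X 1 * addRowE q E K) +
        eps q .bull • (addRow q w z X 2 * addRowK q K) := by
  rw [addRow_one, addRow_two, addRowK_eq, addRowE]
  ext a c : 2
  fin_cases a <;> fin_cases c <;>
    simp only [Matrix.add_apply, Matrix.smul_apply, Matrix.mul_apply, Fin.sum_univ_three,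
      Matrix.of_apply, Matrix.cons_val, Fin.mk_one, Fin.zero_eta, Fin.reduceFinMk,
      zero_mul, mul_zero, add_zero, zero_add, smul_zero, smul_mul_assoc,
      mul_smul_comm, h.K_mul_zero, h.K_mul_one, h.K_mul_two, h.E_mul_zero, h.E_mul_one,
      h.E_mul_two]
  all_goals match_scalars <;> simp only [weight, eps] <;> field_simp <;> ring

set_option maxHeartbeats 1000000 in
theorem addRowE_mul_two (hq0 : q ≠ 0) (h2 : w - q ^ 2 * z ≠ 0) (h3 : w - q ^ 3 * z ≠ 0)
    (h : ColumnRelations q X E K) :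
    addRowE q E K * addRow q w z X 2 = (1 / q ^ 2) • (addRow q w z X 2 * addRowE q E K) := by
  rw [addRow_two, addRowE]
  ext a c : 2
  fin_cases a <;> fin_cases c <;>
    simp only [Matrix.smul_apply, Matrix.mul_apply, Fin.sum_univ_three,
      Matrix.of_apply, Matrix.cons_val, Fin.mk_one, Fin.zero_eta, Fin.reduceFinMk,
      zero_mul, mul_zero, add_zero, zero_add, smul_zero, smul_mul_assoc,
      mul_smul_comm, h.K_mul_one, h.K_mul_two, h.E_mul_zero, h.E_mul_one,
      h.E_mul_two]
  all_goals match_scalars <;> simp only [weight, eps] <;> field_simp <;> ring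

end Blocks

/-! ### The intertwiner -/

/-- The block-triangular intertwiner between the twisted column operators on `n + 1` rows and those
on `n` rows with an untwisted row with parameter `w` on top. -/
noncomputable def intertwiner (q : ℂ) {n : ℕ} (x : Fin n → ℂ) (w : ℂ) :
    Matrix (Fin 3) (Fin 3) (Matrix (Fin n → Fin 3) (Fin n → Fin 3) ℂ) :=
  !![Gamma0 q x w, Gamma1 q x w, Gamma2 q x w; 0, opDiag (midDiag q x w), opMid q x w; 0, 0, 1]

theorem blk_Gamma0_eq (q : ℂ) {n : ℕ} (x : Fin (n + 1) → ℂ) (z : ℂ) :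
    blk (Gamma0 q x z) =
      !![Gamma0 q (fun i => x i.castSucc) z, 0, 0;
        0, weight q (x (Fin.last n)) z 0 1 0 1 • Gamma0 q (fun i => x i.castSucc) z, 0;
        0, 0, weight q (x (Fin.last n)) z 0 2 0 2 • Gamma0 q (fun i => x i.castSucc) z] := by
  ext a c : 1
  rw [blk_Gamma0]
  fin_cases a <;> fin_cases c <;> simp [d, weight]

theorem blk_opE_eq (q : ℂ) {n : ℕ} (x : Fin (n + 1) → ℂ) :
    blk (opE q x) =
      !![opE q (fun i => x i.castSucc), 0, 0;
        eps q .circ • (opK q n * opDiag (dotDiag q (fun i => x i.castSucc) (x (Fin.last n)) .circ)),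
        opEBlock q (fun i => x i.castSucc) (x (Fin.last n)) 1, 0;
        0,
        eps q .bull • (opK q n * opDiag (dotDiag q (fun i => x i.castSucc) (x (Fin.last n)) .bull)),
        opEBlock q (fun i => x i.castSucc) (x (Fin.last n)) 2] := by
  have h : ∀ f : Dot → Matrix (Fin n → Fin 3) (Fin n → Fin 3) ℂ,
      ∑ u, f u = f .circ + f .bull := fun f => Finset.sum_pair (by decide)
  ext a c : 1
  rw [blk_opE, h]
  fin_cases a <;> fin_cases c <;> simp [elemDot, opEBlock_zero]

section Intertwine

variable {q : ℂ} (hq0 : q ≠ 0) (hq1 : 1 - q ≠ 0) (hq2 : 1 + q ≠ 0) {n : ℕ} {x : Fin n → ℂ}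
  {w : ℂ}

include hq0 hq1 hq2

/-- `blk` of $\Gamma_0(z)$ is block diagonal, while the intertwiner and `addRow` at $k=0$ are block
upper triangular. The diagonal entries hold because diagonal operators commute, so only the three
entries above the diagonal have content. -/
theorem blk_Gamma0_mul_intertwiner {x : Fin (n + 1) → ℂ}
    (hx : ∀ i j, i ≠ j → x i ≠ x j) (hxq : ∀ i j, i ≠ j → x i ≠ q * x j)
    (hxq2 : ∀ i j, i ≠ j → x i ≠ q ^ 2 * x j) (hxq3 : ∀ i j, i ≠ j → x i ≠ q ^ 3 * x j)
    {z : ℂ} (hz2 : ∀ i, x i ≠ q ^ 2 * z) (hz3 : ∀ i, x i ≠ q ^ 3 * z) :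
    blk (Gamma0 q x z) * intertwiner q (fun i => x i.castSucc) (x (Fin.last n)) =
      intertwiner q (fun i => x i.castSucc) (x (Fin.last n)) *
        addRow q (x (Fin.last n)) z (fun j => Gamma q (fun i => x i.castSucc) j z) 0 := by
  have hne : ∀ i : Fin n, i.castSucc ≠ Fin.last n := fun i => (Fin.castSucc_lt_last i).ne
  have hwz2 := sub_ne_zero.mpr (hz2 (Fin.last n))
  have hwz3 := sub_ne_zero.mpr (hz3 (Fin.last n))
  have hz2' : ∀ i : Fin n, x i.castSucc - q ^ 2 * z ≠ 0 := fun i => sub_ne_zero.mpr (hz2 _)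
  have hz3' : ∀ i : Fin n, x i.castSucc - q ^ 3 * z ≠ 0 := fun i => sub_ne_zero.mpr (hz3 _)
  have hw2 : ∀ i : Fin n, x i.castSucc - q ^ 2 * x (Fin.last n) ≠ 0 :=
    fun i => sub_ne_zero.mpr (hxq2 _ _ (hne i))
  have hw3 : ∀ i : Fin n, x i.castSucc - q ^ 3 * x (Fin.last n) ≠ 0 :=
    fun i => sub_ne_zero.mpr (hxq3 _ _ (hne i))
  have hx' : ∀ i j : Fin n, i ≠ j → x i.castSucc ≠ x j.castSucc :=
    fun i j h => hx _ _ fun h' => h (Fin.castSucc_injective _ h')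
  have hxq' : ∀ i j : Fin n, i ≠ j → x i.castSucc ≠ q * x j.castSucc :=
    fun i j h => hxq _ _ fun h' => h (Fin.castSucc_injective _ h')
  have e01 := Gamma0_mul_Gamma1 hwz2 hz2' hz3' hw2 hw3
  have e02 := Gamma0_mul_Gamma2 hq0 hq1 hq2 hx' hxq' hwz2 hwz3 hz2' hz3' hw2 hw3
  have e12 := mid_mul_Gamma0 hq2 hwz2 hwz3 hz2' hz3' hw2
  have c0 : ∀ δ : Fin n → Fin 3 → ℂ, Gamma0 q (fun i => x i.castSucc) z * opDiag δ =
      opDiag δ * Gamma0 q (fun i => x i.castSucc) z := fun δ => by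
    rw [Gamma0_eq, opDiag_mul_opDiag, opDiag_mul_opDiag, mul_comm]
  have c1 := c0 (dDiag q (fun i => x i.castSucc) (x (Fin.last n)))
  rw [← Gamma0_eq] at c1
  rw [blk_Gamma0_eq, addRow_zero, intertwiner]
  simp only [Gamma]
  ext a c : 1
  fin_cases a <;> fin_cases c <;>
    simp only [Matrix.mul_apply, Fin.sum_univ_three,
      Matrix.of_apply, Matrix.cons_val, Fin.mk_one, Fin.zero_eta, Fin.reduceFinMk,
      zero_mul, mul_zero, add_zero, zero_add, smul_zero, smul_mul_assoc, mul_smul_comm, one_mul,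
      mul_one, c0, c1]
  · exact e01.symm
  · exact e02.symm
  · exact e12.symm

/-- The top row of the intertwiner consists of the $\Gamma_k(w)$, so the top row of this identity is
exactly the set of relations with $E$ at $z=w$, including the one for $\Gamma_2(w)$. This is why `h`
is assumed on the first $n$ sites. -/
theorem blk_opE_mul_intertwiner {x : Fin (n + 1) → ℂ}
    (hx : ∀ i j, i ≠ j → x i ≠ x j) (hxq : ∀ i j, i ≠ j → x i ≠ q * x j)
    (hxq2 : ∀ i j, i ≠ j → x i ≠ q ^ 2 * x j) (hxq3 : ∀ i j, i ≠ j → x i ≠ q ^ 3 * x j)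
    (h : ColumnRelations q (fun j => Gamma q (fun i => x i.castSucc) j (x (Fin.last n)))
      (opE q fun i => x i.castSucc) (opK q n)) :
    blk (opE q x) * intertwiner q (fun i => x i.castSucc) (x (Fin.last n)) =
      intertwiner q (fun i => x i.castSucc) (x (Fin.last n)) *
        addRowE q (opE q fun i => x i.castSucc) (opK q n) := by
  have hne : ∀ i : Fin n, i.castSucc ≠ Fin.last n := fun i => (Fin.castSucc_lt_last i).ne
  have hw0 : ∀ i : Fin n, x i.castSucc - x (Fin.last n) ≠ 0 :=
    fun i => sub_ne_zero.mpr (hx _ _ (hne i))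
  have hw1 : ∀ i : Fin n, x i.castSucc - q * x (Fin.last n) ≠ 0 :=
    fun i => sub_ne_zero.mpr (hxq _ _ (hne i))
  have hw1' : ∀ i : Fin n, q * x i.castSucc - x (Fin.last n) ≠ 0 :=
    fun i => sub_ne_zero.mpr (hxq _ _ (hne i).symm).symm
  have hw2 : ∀ i : Fin n, x i.castSucc - q ^ 2 * x (Fin.last n) ≠ 0 :=
    fun i => sub_ne_zero.mpr (hxq2 _ _ (hne i))
  have hw3 : ∀ i : Fin n, x i.castSucc - q ^ 3 * x (Fin.last n) ≠ 0 :=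
    fun i => sub_ne_zero.mpr (hxq3 _ _ (hne i))
  have hx' : ∀ i j : Fin n, i ≠ j → x i.castSucc ≠ x j.castSucc :=
    fun i j h => hx _ _ fun h' => h (Fin.castSucc_injective _ h')
  have hxq' : ∀ i j : Fin n, i ≠ j → x i.castSucc ≠ q * x j.castSucc :=
    fun i j h => hxq _ _ fun h' => h (Fin.castSucc_injective _ h')
  have e00 := h.E_mul_zero
  have e01 := h.E_mul_one
  have e02 := h.E_mul_two
  have e11 := mid_mul_opE hq0 hq1 hq2 hw0 hw1 hw1' hw2 hw3
  have e12 := opMid_mul_opE hq0 hq1 hq2 hx' hxq' hw0 hw1 hw1' hw2 hw3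
  have e22 := opE_eq_block hq0 hq1 hq2 hw0 hw1' hw2
  have e10 : opK q n * opDiag (dotDiag q (fun i : Fin n => x i.castSucc) (x (Fin.last n)) .circ) *
      Gamma0 q (fun i => x i.castSucc) (x (Fin.last n)) =
      opDiag (midDiag q (fun i : Fin n => x i.castSucc) (x (Fin.last n))) * opK q n := by
    rw [midDiag_eq hq2 hw0 hw1 hw2 hw3, opK, Gamma0_eq, opDiag_mul_opDiag, opDiag_mul_opDiag,
      opDiag_mul_opDiag, mul_assoc, mul_comm]
  have e21 : opK q n * opDiag (dotDiag q (fun i : Fin n => x i.castSucc) (x (Fin.last n)) .bull) *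
      opDiag (midDiag q (fun i : Fin n => x i.castSucc) (x (Fin.last n))) = opK q n := by
    rw [opK, opDiag_mul_opDiag, opDiag_mul_opDiag, mul_assoc, midDiag_mul hq2 hw0 hw1' hw2,
      mul_one]
  simp only [Gamma] at e00 e01 e02
  rw [blk_opE_eq, addRowE, intertwiner]
  ext a c : 1
  fin_cases a <;> fin_cases c <;>
    simp only [Matrix.mul_apply, Fin.sum_univ_three,
      Matrix.of_apply, Matrix.cons_val, Fin.mk_one, Fin.zero_eta, Fin.reduceFinMk,
      zero_mul, mul_zero, add_zero, zero_add, smul_zero, smul_mul_assoc, mul_smul_comm, one_mul,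
      mul_one, e10, e21]
  · exact e00
  · exact e01
  · exact e02
  · exact e11.symm
  · exact e12.symm
  · exact e22.symm

omit hq0 hq1 hq2 in
theorem blk_opK_mul_intertwiner {x : Fin (n + 1) → ℂ} (hq0 : q ≠ 0)
    (h : ColumnRelations q (fun j => Gamma q (fun i => x i.castSucc) j (x (Fin.last n)))
      (opE q fun i => x i.castSucc) (opK q n)) :
    blk (opK q (n + 1)) * intertwiner q (fun i => x i.castSucc) (x (Fin.last n)) =
      intertwiner q (fun i => x i.castSucc) (x (Fin.last n)) * addRowK q (opK q n) := by
  have k0 := h.K_mul_zero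
  have k1 := h.K_mul_one
  have k2 := h.K_mul_two
  simp only [Gamma] at k0 k1 k2
  have c0 : ∀ δ : Fin n → Fin 3 → ℂ, opK q n * opDiag δ = opDiag δ * opK q n := fun δ => by
    rw [opK, opDiag_mul_opDiag, opDiag_mul_opDiag, mul_comm]
  have c1 : (1 / q ^ 2) • (opK q n * opMid q (fun i => x i.castSucc) (x (Fin.last n))) =
      (1 / q ^ 4) • (opMid q (fun i => x i.castSucc) (x (Fin.last n)) * opK q n) := by
    rw [opMid, opK, opDiag_mul_opOne, opOne_mul_opDiag, opOne_smul, opOne_smul,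
      mul_comm (midDiag q _ _)]
    congr 1
    funext i u
    simp only [kap_tgt hq0, Pi.smul_apply, smul_eq_mul]
    field_simp
  have hb : blk (opK q (n + 1)) = addRowK q (opK q n) := blk_opK q n
  rw [hb, addRowK_eq, intertwiner]
  ext a c : 1
  fin_cases a <;> fin_cases c <;>
    simp only [Matrix.mul_apply, Fin.sum_univ_three,
      Matrix.of_apply, Matrix.cons_val, Fin.mk_one, Fin.zero_eta, Fin.reduceFinMk,
      zero_mul, mul_zero, add_zero, zero_add, smul_zero, smul_mul_assoc, mul_smul_comm, one_mul,
      mul_one, k0, k1, k2, c0]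
  exact c1

end Intertwine

/-! ### Transfer of the intertwining relation to $\Gamma_1$ and $\Gamma_2$, and induction on the
number of sites -/

theorem opDiag_eq_diagonal {n : ℕ} (δ : Fin n → Fin 3 → ℂ) :
    opDiag δ = Matrix.diagonal fun s => ∏ i, δ i (s i) := by
  ext s t
  rw [Matrix.diagonal_apply]
  simp only [opDiag, tensor, Matrix.of_apply, Matrix.diagonal_apply]
  split_ifs with h
  · subst h; simp
  · obtain ⟨i, hi⟩ := Function.ne_iff.mp h
    exact Finset.prod_eq_zero (Finset.mem_univ i) (if_neg hi)

theorem opDiag_mul_inv {n : ℕ} {δ : Fin n → Fin 3 → ℂ} (h : ∀ i a, δ i a ≠ 0) :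
    opDiag δ * opDiag (fun i a => (δ i a)⁻¹) = 1 := by
  rw [opDiag_mul_opDiag, opDiag_eq_diagonal, ← Matrix.diagonal_one]
  congr 1
  funext s
  exact Finset.prod_eq_one fun i _ => mul_inv_cancel₀ (h i (s i))

/-- Moving `G` through the relation for $EX$ cancels the terms with $X$ and leaves $YKG=GY'K'$.
Since $KG=GK'$ and $K'$ has a right inverse, $K'$ can be removed. -/
theorem intertwine_transfer {R : Type*} [Ring R] [Algebra ℂ R] {E X Y K E' X' Y' K' Ki G : R}
    {c e : ℂ} (he : e ≠ 0) (h : E * X = c • (X * E) + e • (Y * K))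
    (h' : E' * X' = c • (X' * E') + e • (Y' * K')) (hE : E * G = G * E') (hX : X * G = G * X')
    (hK : K * G = G * K') (hKi : K' * Ki = 1) : Y * G = G * Y' := by
  have h1 : e • (Y * (K * G)) = e • (G * Y' * K') := by
    have a1 : E * X * G = G * (E' * X') := by rw [mul_assoc, hX, ← mul_assoc, hE, mul_assoc]
    have a2 : X * E * G = G * (X' * E') := by rw [mul_assoc, hE, ← mul_assoc, hX, mul_assoc]
    rw [h, h', add_mul, smul_mul_assoc, a2, mul_add, mul_smul_comm, mul_smul_comm,
      smul_mul_assoc, add_right_inj] at a1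
    rw [← mul_assoc, a1, mul_assoc]
  have h2 := smul_right_injective R he h1
  rw [hK, ← mul_assoc] at h2
  have h3 := congrArg (· * Ki) h2
  simpa only [mul_assoc, hKi, mul_one] using h3

section Induction

variable {q : ℂ} (hq0 : q ≠ 0) (hq1 : 1 - q ≠ 0) (hq2 : 1 + q ≠ 0)

include hq0 hq1 hq2

omit hq0 hq1 in
-- The intertwiner is block upper triangular with invertible diagonal blocks, so the block columns
-- of `A` vanish one after the other.
theorem intertwiner_mul_right_cancel {n : ℕ} {x : Fin n → ℂ} {w : ℂ} (hw0 : ∀ i, x i - w ≠ 0)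
    (hw1 : ∀ i, x i - q * w ≠ 0) (hw1' : ∀ i, q * x i - w ≠ 0) (hw2 : ∀ i, x i - q ^ 2 * w ≠ 0)
    (hw3 : ∀ i, x i - q ^ 3 * w ≠ 0)
    {A : Matrix (Fin 3) (Fin 3) (Matrix (Fin n → Fin 3) (Fin n → Fin 3) ℂ)}
    (h : A * intertwiner q x w = 0) : A = 0 := by
  have i0 : Gamma0 q x w * opDiag (fun i a => (dDiag q x w i a)⁻¹) = 1 := by
    rw [Gamma0_eq]
    refine opDiag_mul_inv fun i a => ?_
    fin_cases a <;> simp [dDiag, d, hw0, hw1, hw2, hw3]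
  have i1 : opDiag (midDiag q x w) * opDiag (fun i a => (midDiag q x w i a)⁻¹) = 1 := by
    refine opDiag_mul_inv fun i a => ?_
    fin_cases a <;> simp [midDiag, hw0, hw1', hw2, hq2]
  have e : ∀ a c, A a 0 * intertwiner q x w 0 c + A a 1 * intertwiner q x w 1 c +
      A a 2 * intertwiner q x w 2 c = 0 := fun a c => by
    have := congrFun (congrFun h a) c
    rwa [Matrix.mul_apply, Fin.sum_univ_three] at this
  have h0 : ∀ a, A a 0 = 0 := fun a => by
    have := e a 0
    simp only [intertwiner, Matrix.of_apply, Matrix.cons_val, mul_zero, add_zero] at this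
    rw [← mul_one (A a 0), ← i0, ← mul_assoc, this, zero_mul]
  have h1 : ∀ a, A a 1 = 0 := fun a => by
    have := e a 1
    simp only [intertwiner, Matrix.of_apply, Matrix.cons_val, mul_zero, add_zero, h0, zero_mul,
      zero_add] at this
    rw [← mul_one (A a 1), ← i1, ← mul_assoc, this, zero_mul]
  have h2 : ∀ a, A a 2 = 0 := fun a => by
    have := e a 2
    simpa only [intertwiner, Matrix.of_apply, Matrix.cons_val, mul_one, h0, h1, zero_mul,
      zero_add] using this
  ext a c : 1
  fin_cases c
  · exact h0 a
  · exact h1 a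
  · exact h2 a

/-- Only $k=0$ needs a computation: `intertwine_transfer` passes from $\Gamma_0$ to $\Gamma_1$ and
then from $\Gamma_1$ to $\Gamma_2$. -/
theorem blk_Gamma_mul_intertwiner {n : ℕ} {x : Fin (n + 1) → ℂ}
    (hx : ∀ i j, i ≠ j → x i ≠ x j) (hxq : ∀ i j, i ≠ j → x i ≠ q * x j)
    (hxq2 : ∀ i j, i ≠ j → x i ≠ q ^ 2 * x j) (hxq3 : ∀ i j, i ≠ j → x i ≠ q ^ 3 * x j)
    {z : ℂ} (hz2 : ∀ i, x i ≠ q ^ 2 * z) (hz3 : ∀ i, x i ≠ q ^ 3 * z)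
    (hz : ColumnRelations q (fun j => Gamma q (fun i => x i.castSucc) j z)
      (opE q fun i => x i.castSucc) (opK q n))
    (hw : ColumnRelations q (fun j => Gamma q (fun i => x i.castSucc) j (x (Fin.last n)))
      (opE q fun i => x i.castSucc) (opK q n)) (k : Fin 3) :
    blk (Gamma q x k z) * intertwiner q (fun i => x i.castSucc) (x (Fin.last n)) =
      intertwiner q (fun i => x i.castSucc) (x (Fin.last n)) *
        addRow q (x (Fin.last n)) z (fun j => Gamma q (fun i => x i.castSucc) j z) k := by
  have hwz2 := sub_ne_zero.mpr (hz2 (Fin.last n))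
  have hwz3 := sub_ne_zero.mpr (hz3 (Fin.last n))
  have hz2' : ∀ i, x i - q ^ 2 * z ≠ 0 := fun i => sub_ne_zero.mpr (hz2 i)
  have hz3' : ∀ i, x i - q ^ 3 * z ≠ 0 := fun i => sub_ne_zero.mpr (hz3 i)
  have g0 := blk_Gamma0_mul_intertwiner hq0 hq1 hq2 hx hxq hxq2 hxq3 hz2 hz3
  have gE := blk_opE_mul_intertwiner hq0 hq1 hq2 hx hxq hxq2 hxq3 hw
  have gK := blk_opK_mul_intertwiner hq0 hw
  have hK : addRowK q (opK q n) * blk (opDiag fun _ a => (kap q a)⁻¹) = 1 := by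
    have : addRowK q (opK q n) = blk (opK q (n + 1)) := (blk_opK q n).symm
    rw [this, ← blk_mul, opK, opDiag_mul_inv, blk_one]
    intro i a
    fin_cases a <;> simp [kap, hq0]
  have b0 : blk (opE q x) * blk (Gamma0 q x z) = (1 : ℂ) • (blk (Gamma0 q x z) * blk (opE q x)) +
      eps q .circ • (blk (Gamma1 q x z) * blk (opK q (n + 1))) := by
    rw [one_smul, ← blk_mul, ← blk_mul, ← blk_mul, ← blk_smul, ← blk_add,
      opE_mul_Gamma0 hq0 hz2' hz3']
  have b1 : blk (opE q x) * blk (Gamma1 q x z) =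
      (-1 / q) • (blk (Gamma1 q x z) * blk (opE q x)) +
      eps q .bull • (blk (Gamma2 q x z) * blk (opK q (n + 1))) := by
    rw [← blk_mul, ← blk_mul, ← blk_mul, ← blk_smul, ← blk_smul, ← blk_add,
      opE_mul_Gamma1 hq0 hq1 hq2 hx hxq hz2' hz3']
  have m0 := addRowE_mul_zero hq0 hwz2 hwz3 hz
  have m1 := addRowE_mul_one hq0 hwz2 hwz3 hz
  rw [← one_smul ℂ (addRow _ _ _ _ 0 * _)] at m0
  have g1 := intertwine_transfer (by simp [eps, hq0, hq1, hq2]) b0 m0 gE g0 gK hK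
  have g2 := intertwine_transfer (by simp [eps, hq0, hq1, hq2]) b1 m1 gE g1 gK hK
  fin_cases k
  · exact g0
  · exact g1
  · exact g2

/-- Five of the six relations hold on any number of sites without induction; the induction serves
only $E\,\Gamma_2=q^{-2}\,\Gamma_2E$. -/
theorem columnRelations_Gamma : ∀ {n : ℕ} {x : Fin n → ℂ}
    (_ : ∀ i j, i ≠ j → x i ≠ x j) (_ : ∀ i j, i ≠ j → x i ≠ q * x j)
    (_ : ∀ i j, i ≠ j → x i ≠ q ^ 2 * x j) (_ : ∀ i j, i ≠ j → x i ≠ q ^ 3 * x j)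
    {z : ℂ} (_ : ∀ i, x i ≠ q ^ 2 * z) (_ : ∀ i, x i ≠ q ^ 3 * z),
    ColumnRelations q (fun j => Gamma q x j z) (opE q x) (opK q n) := by
  intro n
  induction n with
  | zero =>
    intro x hx hxq hxq2 hxq3 z hz2 hz3
    refine ⟨opK_mul_Gamma0 z, opK_mul_Gamma1 hq0 z, opK_mul_Gamma2 hq0 hq1 hq2 hxq z,
      opE_mul_Gamma0 hq0 (fun i => sub_ne_zero.mpr (hz2 i)) fun i => sub_ne_zero.mpr (hz3 i),
      opE_mul_Gamma1 hq0 hq1 hq2 hx hxq (fun i => sub_ne_zero.mpr (hz2 i))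
        fun i => sub_ne_zero.mpr (hz3 i), ?_⟩
    -- Without sites `opE` is an empty sum.
    simp [opE, opOne]
  | succ n ih =>
    intro x hx hxq hxq2 hxq3 z hz2 hz3
    refine ⟨opK_mul_Gamma0 z, opK_mul_Gamma1 hq0 z, opK_mul_Gamma2 hq0 hq1 hq2 hxq z,
      opE_mul_Gamma0 hq0 (fun i => sub_ne_zero.mpr (hz2 i)) fun i => sub_ne_zero.mpr (hz3 i),
      opE_mul_Gamma1 hq0 hq1 hq2 hx hxq (fun i => sub_ne_zero.mpr (hz2 i))
        fun i => sub_ne_zero.mpr (hz3 i), ?_⟩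
    have hne : ∀ i : Fin n, i.castSucc ≠ Fin.last n := fun i => (Fin.castSucc_lt_last i).ne
    have hcs : ∀ i j : Fin n, i ≠ j → i.castSucc ≠ j.castSucc :=
      fun i j h h' => h (Fin.castSucc_injective _ h')
    have ih' := @ih (fun i => x i.castSucc) (fun i j h => hx _ _ (hcs i j h))
      (fun i j h => hxq _ _ (hcs i j h)) (fun i j h => hxq2 _ _ (hcs i j h))
      (fun i j h => hxq3 _ _ (hcs i j h))
    have hz := ih' (fun i => hz2 i.castSucc) fun i => hz3 i.castSucc
    -- The induction hypothesis is also used at $z=w=x_{n+1}$; here the extra conditions $x_i\ne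
    -- q^2x_j$ and $x_i\ne q^3x_j$ enter.
    have hw := ih' (fun i => hxq2 _ _ (hne i)) fun i => hxq3 _ _ (hne i)
    have g2 := blk_Gamma_mul_intertwiner hq0 hq1 hq2 hx hxq hxq2 hxq3 hz2 hz3 hz hw 2
    have gE := blk_opE_mul_intertwiner hq0 hq1 hq2 hx hxq hxq2 hxq3 hw
    have m2 := addRowE_mul_two hq0 (sub_ne_zero.mpr (hz2 (Fin.last n)))
      (sub_ne_zero.mpr (hz3 (Fin.last n))) hz
    -- The difference of the two sides is multiplied by the intertwiner, carried through to the
    -- `addRow` side, where it vanishes by `m2`, and the intertwiner is then cancelled.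
    refine sub_eq_zero.mp (blk_injective ?_)
    refine intertwiner_mul_right_cancel hq2 (x := fun i => x i.castSucc)
      (w := x (Fin.last n)) (fun i => sub_ne_zero.mpr (hx _ _ (hne i)))
      (fun i => sub_ne_zero.mpr (hxq _ _ (hne i)))
      (fun i => sub_ne_zero.mpr (hxq _ _ (hne i).symm).symm)
      (fun i => sub_ne_zero.mpr (hxq2 _ _ (hne i)))
      (fun i => sub_ne_zero.mpr (hxq3 _ _ (hne i))) ?_
    have hb : blk (opE q x * Gamma q x 2 z - (1 / q ^ 2) • (Gamma q x 2 z * opE q x)) =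
        blk (opE q x) * blk (Gamma q x 2 z) -
          (1 / q ^ 2) • (blk (Gamma q x 2 z) * blk (opE q x)) := by
      rw [← blk_mul, ← blk_mul]
      rfl
    rw [hb, sub_mul, smul_mul_assoc, mul_assoc, g2, mul_assoc (blk (Gamma q x 2 z)), gE,
      ← mul_assoc, gE, ← mul_assoc, g2, mul_assoc, m2, mul_assoc, mul_smul_comm, sub_self]

end Induction

/-! ### Products of column operators -/

theorem list_prod_intertwine {M : Type*} [Monoid M] {G : M} :
    ∀ {L : ℕ} {f g : Fin L → M}, (∀ k, f k * G = G * g k) →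
      (List.ofFn f).prod * G = G * (List.ofFn g).prod := by
  intro L
  induction L with
  | zero => intro f g _; simp
  | succ L ih =>
    intro f g h
    rw [List.ofFn_succ, List.ofFn_succ, List.prod_cons, List.prod_cons, mul_assoc,
      ih fun k => h k.succ, ← mul_assoc, h 0, mul_assoc]

theorem blk_list_prod {n : ℕ} : ∀ {L : ℕ}
    (f : Fin L → Matrix (Fin (n + 1) → Fin 3) (Fin (n + 1) → Fin 3) ℂ),
    blk (List.ofFn f).prod = (List.ofFn fun k => blk (f k)).prod := by
  intro L
  induction L with
  | zero => intro f; simp [blk_one]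
  | succ L ih =>
    intro f
    rw [List.ofFn_succ, List.ofFn_succ, List.prod_cons, List.prod_cons, blk_mul, ih]

theorem rowOp_cons (q w : ℂ) (z : ℕ → ℂ) (L : ℕ) (a b : Fin 3) (I S : Fin (L + 1) → Fin 3) :
    rowOp q w z (L + 1) a b I S = ∑ c, weight q w (z 0) (I 0) a (S 0) c *
      rowOp q w (fun k => z (k + 1)) L c b (fun k => I k.succ) fun k => S k.succ := by
  simp only [rowOp, Matrix.of_apply]
  rw [← (Fin.consEquiv (fun _ : Fin (L + 2) => Fin 3)).sum_comp, Fintype.sum_prod_type]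
  rw [Finset.sum_eq_single_of_mem a (Finset.mem_univ _)]
  · simp only [Finset.mul_sum]
    rw [Finset.sum_comm]
    refine Finset.sum_congr rfl fun h _ => ?_
    rw [Finset.sum_eq_single_of_mem (h 0) (Finset.mem_univ _)]
    · have hl : (Fin.cons a h : Fin (L + 2) → Fin 3) (Fin.last (L + 1)) = h (Fin.last L) := rfl
      have hc : ∀ k : Fin L, (Fin.cons a h : Fin (L + 2) → Fin 3) k.succ.castSucc =
          h k.castSucc := fun k => rfl
      simp only [Fin.consEquiv, Equiv.coe_fn_mk, Fin.cons_zero, hl, true_and,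
        Fin.prod_univ_succ (n := L), Fin.castSucc_zero, Fin.cons_succ, Fin.val_zero, Fin.val_succ,
        mul_ite, mul_zero, hc]
    · intro c _ hc
      rw [if_neg (fun h' => hc h'.1.symm), mul_zero]
  · intro t _ ht
    refine Finset.sum_eq_zero fun h _ => if_neg fun h' => ht ?_
    simpa [Fin.consEquiv] using h'.1

/-- Matrix multiplication of the $3\times3$ blocks sums over the interior horizontal edges of the
added row, while the sum inside each block runs over the vertical edges below it. -/
theorem addRow_list_prod {R : Type*} [Ring R] [Algebra ℂ R] (q w : ℂ) : ∀ {L : ℕ} (z : ℕ → ℂ)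
    (X : Fin L → Fin 3 → R) (S : Fin L → Fin 3) (a b : Fin 3),
    (List.ofFn fun k : Fin L => addRow q w (z k) (X k) (S k)).prod a b =
      ∑ I : Fin L → Fin 3, rowOp q w z L a b I S • (List.ofFn fun k => X k (I k)).prod := by
  intro L
  induction L with
  | zero =>
    intro z X S a b
    simp only [List.ofFn_zero, List.prod_nil, Finset.univ_unique, Finset.sum_singleton, rowOp,
      Matrix.of_apply]
    rw [← (Equiv.funUnique (Fin 1) (Fin 3)).symm.sum_comp]
    by_cases hab : a = b
    · subst hab; simp
    · have : ∀ t : Fin 3, ¬ (t = a ∧ t = b) := fun t h => hab (h.1.symm.trans h.2)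
      simp [hab, this]
  | succ L ih =>
    intro z X S a b
    have h := fun c => ih (fun k => z (k + 1)) (fun k => X k.succ) (fun k => S k.succ) c b
    rw [List.ofFn_succ, List.prod_cons, Matrix.mul_apply]
    simp only [Fin.val_succ, Fin.val_zero, h]
    rw [← (Fin.consEquiv (fun _ : Fin (L + 1) => Fin 3)).sum_comp, Fintype.sum_prod_type]
    simp only [Fin.consEquiv, Equiv.coe_fn_mk, rowOp_cons, Fin.cons_zero, Fin.cons_succ,
      List.ofFn_succ, List.prod_cons, addRow, Matrix.of_apply, Finset.sum_mul_sum,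
      Finset.sum_smul, smul_mul_smul_comm]
    rw [Finset.sum_comm]
    exact Finset.sum_congr rfl fun t _ => Finset.sum_comm

/-! ### Recursions in the number of rows -/

theorem F_succ (q : ℂ) {n : ℕ} (x : Fin (n + 1) → ℂ) (z : ℕ → ℂ) (S : TwoString) (L : ℕ)
    (hL : ∀ k, L ≤ k → S k = 0) :
    F q x z S = ∑ I : Fin L → Fin 3, rowOp q (x (Fin.last n)) z L 2 0 I (fun k => S k) *
      F q (fun i => x i.castSucc) z (extend I) := by
  unfold F
  rw [List.ofFn_succ', List.concat_eq_append, List.prod_append, List.prod_singleton,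
    Module.End.mul_apply, opC_ket q z _ S L hL, truncC, map_sum, Finsupp.finsetSum_apply]
  simp only [map_smul, Finsupp.smul_apply, smul_eq_mul]

theorem extend_apply {L : ℕ} (I : Fin L → Fin 3) (k : Fin L) : extend I k = I k := by
  simp [extend]

theorem extend_apply_of_le {L : ℕ} (I : Fin L → Fin 3) {k : ℕ} (h : L ≤ k) :
    extend I k = 0 := by
  simp [extend, Nat.not_lt.mpr h]

theorem GammaProd_succ {q : ℂ} (hq0 : q ≠ 0) (hq1 : 1 - q ≠ 0) (hq2 : 1 + q ≠ 0) {n : ℕ}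
    {x : Fin (n + 1) → ℂ} (hx : ∀ i j, i ≠ j → x i ≠ x j) (hxq : ∀ i j, i ≠ j → x i ≠ q * x j)
    (hxq2 : ∀ i j, i ≠ j → x i ≠ q ^ 2 * x j) (hxq3 : ∀ i j, i ≠ j → x i ≠ q ^ 3 * x j)
    {z : ℕ → ℂ} {L : ℕ} (hz2 : ∀ i, ∀ k < L, x i ≠ q ^ 2 * z k)
    (hz3 : ∀ i, ∀ k < L, x i ≠ q ^ 3 * z k) (S : TwoString) :
    GammaProd q x z S L (fun _ => 2) (fun _ => 0) =
      ∑ I : Fin L → Fin 3, rowOp q (x (Fin.last n)) z L 2 0 I (fun k => S k) *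
        GammaProd q (fun i => x i.castSucc) z (extend I) L (fun _ => 2) (fun _ => 0) := by
  have hne : ∀ i : Fin n, i.castSucc ≠ Fin.last n := fun i => (Fin.castSucc_lt_last i).ne
  have hcs : ∀ i j : Fin n, i ≠ j → i.castSucc ≠ j.castSucc :=
    fun i j h h' => h (Fin.castSucc_injective _ h')
  have rel := @columnRelations_Gamma q hq0 hq1 hq2 n (fun i => x i.castSucc)
    (fun i j h => hx _ _ (hcs i j h))
    (fun i j h => hxq _ _ (hcs i j h)) (fun i j h => hxq2 _ _ (hcs i j h))
    (fun i j h => hxq3 _ _ (hcs i j h))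
  have hw := rel (fun i => hxq2 _ _ (hne i)) fun i => hxq3 _ _ (hne i)
  have key := list_prod_intertwine fun k : Fin L =>
    blk_Gamma_mul_intertwiner hq0 hq1 hq2 hx hxq hxq2 hxq3 (fun i => hz2 i k k.2)
      (fun i => hz3 i k k.2)
      (rel (fun i => hz2 i.castSucc k k.2) fun i => hz3 i.castSucc k k.2) hw (S k)
  -- The $(2,0)$ block encodes the boundary states of the added row, and its entry at $(2^n,0^n)$ is
  -- the required matrix element on the remaining sites.
  have key2 := congrFun (congrFun (congrFun (congrFun key 2) 0) fun _ => 2) fun _ => 0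
  rw [Matrix.mul_apply, Matrix.mul_apply, Fin.sum_univ_three, Fin.sum_univ_three] at key2
  simp only [intertwiner, Matrix.of_apply, Matrix.cons_val, mul_zero, add_zero, zero_mul,
    zero_add, one_mul, Gamma0_eq, opDiag_eq_diagonal, Matrix.mul_diagonal] at key2
  -- The leftover factor is the entry of $\Gamma_0(w)$ at the state $0^n$, which is $1$.
  rw [Finset.prod_eq_one (fun i _ => by simp [dDiag, d]), mul_one, ← blk_list_prod] at key2
  have hs : ∀ a : Fin 3, (Fin.snoc (α := fun _ => Fin 3) (fun _ : Fin n => a) a :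
      Fin (n + 1) → Fin 3) = fun _ => a := fun a => by
    funext i
    refine Fin.lastCases ?_ (fun i => ?_) i
    · simp
    · simp
  simp only [blk, Matrix.of_apply, hs] at key2
  have hexp := addRow_list_prod q (x (Fin.last n)) z
    (fun (k : Fin L) j => Gamma q (fun i => x i.castSucc) j (z k)) (fun k => S k) 2 0
  unfold GammaProd
  rw [key2, hexp]
  simp only [extend_apply, Matrix.sum_apply, Matrix.smul_apply, smul_eq_mul]

theorem F_eq_GammaProd_of_generic {q : ℂ} (hq0 : q ≠ 0) (hq1 : 1 - q ≠ 0) (hq2 : 1 + q ≠ 0)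
    (z : ℕ → ℂ) (L : ℕ) : ∀ {n : ℕ} {x : Fin n → ℂ} (_ : ∀ i j, i ≠ j → x i ≠ x j)
    (_ : ∀ i j, i ≠ j → x i ≠ q * x j) (_ : ∀ i j, i ≠ j → x i ≠ q ^ 2 * x j)
    (_ : ∀ i j, i ≠ j → x i ≠ q ^ 3 * x j) (_ : ∀ i, ∀ k < L, x i ≠ q ^ 2 * z k)
    (_ : ∀ i, ∀ k < L, x i ≠ q ^ 3 * z k) (S : TwoString) (_ : ∀ k, L ≤ k → S k = 0),
    F q x z S = GammaProd q x z S L (fun _ => 2) (fun _ => 0) := by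
  intro n
  induction n with
  | zero =>
    intro x _ _ _ _ _ _ S hS
    have h1 : F q x z S = if S = 0 then 1 else 0 := by
      simp [F, ket, Finsupp.single_apply]
    -- Without sites $\Gamma_1$ and $\Gamma_2$ are empty sums and $\Gamma_0=1$, so the product
    -- detects whether $S=\varnothing$.
    have h0 : ∀ (k : Fin 3) (z : ℂ), k ≠ 0 → Gamma q x k z = 0 := by
      intro k z hk
      fin_cases k
      · exact absurd rfl hk
      · simp [Gamma, Gamma1]
      · simp [Gamma, Gamma2]
    have h00 : ∀ z : ℂ, Gamma q x 0 z = 1 := by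
      intro z
      ext a b
      have : a = b := Subsingleton.elim _ _
      subst this
      simp [Gamma, Gamma0, tensor]
    rw [h1]
    unfold GammaProd
    split_ifs with h
    · subst h
      simp [h00, Subsingleton.elim (fun _ : Fin 0 => (2 : Fin 3)) fun _ => 0]
    · obtain ⟨k, hk⟩ := Finsupp.ne_iff.mp h
      have hkL : k < L := by
        by_contra hk'
        exact hk (hS k (by omega))
      rw [List.prod_eq_zero]
      · rfl
      · rw [List.mem_ofFn]
        exact ⟨⟨k, hkL⟩, h0 _ _ hk⟩
  | succ n ih =>
    intro x hx hxq hxq2 hxq3 hz2 hz3 S hS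
    have hcs : ∀ i j : Fin n, i ≠ j → i.castSucc ≠ j.castSucc :=
      fun i j h h' => h (Fin.castSucc_injective _ h')
    rw [F_succ q x z S L hS, GammaProd_succ hq0 hq1 hq2 hx hxq hxq2 hxq3 hz2 hz3]
    refine Finset.sum_congr rfl fun I _ => ?_
    rw [ih (fun i j h => hx _ _ (hcs i j h)) (fun i j h => hxq _ _ (hcs i j h))
      (fun i j h => hxq2 _ _ (hcs i j h)) (fun i j h => hxq3 _ _ (hcs i j h))
      (fun i => hz2 i.castSucc) (fun i => hz3 i.castSucc) _ fun k hk => extend_apply_of_le I hk]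

theorem bra2_dotProduct_ket0 {N : ℕ} (A : Matrix (Fin N → Fin 3) (Fin N → Fin 3) ℂ) :
    dotProduct (bra2 N) (Matrix.mulVec A (ket0 N)) = A (fun _ => 2) (fun _ => 0) := by
  have h : ∀ (v : Fin 3 → ℂ) (c : Fin 3), v = Pi.single c 1 →
      (fun a : Fin N → Fin 3 => ∏ i, v (a i)) = Pi.single (fun _ => c) 1 := by
    intro v c hv
    subst hv
    funext a
    by_cases ha : a = fun _ => c
    · subst ha; simp
    · rw [Pi.single_eq_of_ne ha]
      obtain ⟨i, hi⟩ := Function.ne_iff.mp ha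
      exact Finset.prod_eq_zero (Finset.mem_univ i) (Pi.single_eq_of_ne hi _)
  have h2 : bra2 N = Pi.single (fun _ => 2) 1 := h _ 2 (by
    funext a; fin_cases a <;> simp)
  have h0 : ket0 N = Pi.single (fun _ => 0) 1 := h _ 0 (by
    funext a; fin_cases a <;> simp)
  rw [h2, h0, single_one_dotProduct, Matrix.mulVec_single_one]
  rfl

/-! ### Continuity in the row parameters -/

open Filter Topology

section Continuity

variable {q z : ℂ} {x y : ℂ → ℂ} {t₀ : ℂ}

theorem continuousAt_diagonal {f : ℂ → Fin 3 → ℂ} (hf : ∀ a, ContinuousAt (fun t => f t a) t₀) :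
    ContinuousAt (fun t => Matrix.diagonal (f t)) t₀ :=
  (continuous_id.matrix_diagonal).continuousAt.comp (continuousAt_pi.mpr hf)

theorem continuousAt_smul_const {f : ℂ → ℂ} (hf : ContinuousAt f t₀)
    (A : Matrix (Fin 3) (Fin 3) ℂ) : ContinuousAt (fun t => f t • A) t₀ :=
  hf.smul continuousAt_const

theorem continuousAt_tensor {n : ℕ} {A : ℂ → Fin n → Matrix (Fin 3) (Fin 3) ℂ}
    (hA : ∀ i, ContinuousAt (fun t => A t i) t₀) : ContinuousAt (fun t => tensor (A t)) t₀ := by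
  refine continuousAt_pi.mpr fun a => continuousAt_pi.mpr fun b => ?_
  change ContinuousAt (fun t => ∏ i, A t i (a i) (b i)) t₀
  exact tendsto_finsetProd _ fun i _ =>
    continuousAt_pi.mp (continuousAt_pi.mp (hA i) (a i)) (b i)

theorem continuousAt_weight (hx : ContinuousAt x t₀) (h2 : x t₀ ≠ q ^ 2 * z)
    (h3 : x t₀ ≠ q ^ 3 * z) (i j k l : Fin 3) :
    ContinuousAt (fun t => weight q (x t) z i j k l) t₀ := by
  have h2' := sub_ne_zero.mpr h2
  have h23 := mul_ne_zero h2' (sub_ne_zero.mpr h3)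
  unfold weight
  split <;> fun_prop (disch := assumption)

theorem continuousAt_d (hx : ContinuousAt x t₀) (h2 : x t₀ ≠ q ^ 2 * z)
    (h3 : x t₀ ≠ q ^ 3 * z) : ContinuousAt (fun t => d q (x t) z) t₀ := by
  have h2' := sub_ne_zero.mpr h2
  have h23 := mul_ne_zero h2' (sub_ne_zero.mpr h3)
  refine continuousAt_diagonal fun a => ?_
  fin_cases a
  · exact continuousAt_const
  · change ContinuousAt (fun t => (x t - z) / (x t - q ^ 2 * z)) t₀
    fun_prop (disch := assumption)
  · change ContinuousAt (fun t => (x t - z) * (x t - q * z) /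
      ((x t - q ^ 2 * z) * (x t - q ^ 3 * z))) t₀
    fun_prop (disch := assumption)

theorem continuousAt_dDot (hq : 1 + q ≠ 0) (hx : ContinuousAt x t₀) (hy : ContinuousAt y t₀)
    (h0 : x t₀ ≠ y t₀) (h1 : x t₀ ≠ q * y t₀) (h1' : y t₀ ≠ q * x t₀) (u : Dot) :
    ContinuousAt (fun t => dDot q (x t) (y t) u) t₀ := by
  have h0' := sub_ne_zero.mpr h0
  have h00 := mul_ne_zero hq h0'
  have h2 := sub_ne_zero.mpr h1
  have h3 := sub_ne_zero.mpr h1'.symm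
  cases u
  · refine continuousAt_diagonal fun a => ?_
    fin_cases a
    · exact continuousAt_const
    · change ContinuousAt (fun t => (q * x t - y t) * (x t - q ^ 2 * y t) /
        ((1 + q) * (x t - y t))) t₀
      fun_prop (disch := assumption)
    · change ContinuousAt (fun t => (x t - q ^ 3 * y t) / (x t - q * y t)) t₀
      fun_prop (disch := assumption)
  · refine continuousAt_diagonal fun a => ?_
    fin_cases a
    · exact continuousAt_const
    · change ContinuousAt (fun t => (1 + q) / (q * x t - y t)) t₀
      fun_prop (disch := assumption)
    · change ContinuousAt (fun t => (x t - q ^ 2 * y t) / (x t - y t)) t₀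
      fun_prop (disch := assumption)

theorem continuousAt_dBoth (hx : ContinuousAt x t₀) (hy : ContinuousAt y t₀)
    (h0 : x t₀ ≠ y t₀) (h1 : x t₀ ≠ q * y t₀) :
    ContinuousAt (fun t => dBoth q (x t) (y t)) t₀ := by
  have h0' := sub_ne_zero.mpr h0
  have h2 := mul_ne_zero h0' (sub_ne_zero.mpr h1)
  refine continuousAt_diagonal fun a => ?_
  fin_cases a
  · exact continuousAt_const
  · change ContinuousAt (fun t => (x t - q ^ 2 * y t) / (x t - y t)) t₀
    fun_prop (disch := assumption)
  · change ContinuousAt (fun t => (x t - q ^ 2 * y t) * (x t - q ^ 3 * y t) /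
      ((x t - y t) * (x t - q * y t))) t₀
    fun_prop (disch := assumption)

theorem continuousAt_eDot (hx : ContinuousAt x t₀) (h2 : x t₀ ≠ q ^ 2 * z)
    (h3 : x t₀ ≠ q ^ 3 * z) (u : Dot) : ContinuousAt (fun t => eDot q (x t) z u) t₀ := by
  have h2' := sub_ne_zero.mpr h2
  have h23 := mul_ne_zero h2' (sub_ne_zero.mpr h3)
  cases u
  · exact continuousAt_smul_const (f := fun t => (1 - q ^ 2) * z / (x t - q ^ 2 * z))
      (by fun_prop (disch := assumption)) _
  · exact continuousAt_smul_const (f := fun t => q * (1 - q) ^ 2 * (1 + q) * (x t - z) * z /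
      ((x t - q ^ 2 * z) * (x t - q ^ 3 * z)))
      (by fun_prop (disch := assumption)) _

theorem continuousAt_eBoth (hx : ContinuousAt x t₀) (h2 : x t₀ ≠ q ^ 2 * z)
    (h3 : x t₀ ≠ q ^ 3 * z) : ContinuousAt (fun t => eBoth q (x t) z) t₀ := by
  have h23 := mul_ne_zero (sub_ne_zero.mpr h2) (sub_ne_zero.mpr h3)
  exact continuousAt_smul_const (f := fun t => (1 - q ^ 2) * (x t + q ^ 2 * x t - q ^ 2 * z - q ^ 3 * z) *
    z / ((x t - q ^ 2 * z) * (x t - q ^ 3 * z))) (by fun_prop (disch := assumption)) _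

theorem continuousAt_pairCoeff (hq0 : q ≠ 0) (hq1 : 1 - q ≠ 0) (hx : ContinuousAt x t₀)
    (hy : ContinuousAt y t₀) (h0 : x t₀ ≠ y t₀) (h1 : x t₀ ≠ q * y t₀) (h1' : y t₀ ≠ q * x t₀)
    (u v : Dot) : ContinuousAt (fun t => pairCoeff q (x t) (y t) z u v) t₀ := by
  by_cases hz : z = 0
  -- At $z=0$ every `pairCoeff` is the constant $0$ by the convention for division by zero.
  · subst hz
    cases u <;> cases v <;> simp only [pairCoeff, mul_zero, div_zero] <;> exact continuousAt_const
  · have e1 := mul_ne_zero (mul_ne_zero (mul_ne_zero hq0 hq1) (sub_ne_zero.mpr h0)) hz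
    have e2 := mul_ne_zero (mul_ne_zero (mul_ne_zero hq0 hq1) (sub_ne_zero.mpr h0.symm)) hz
    have e3 := mul_ne_zero (mul_ne_zero (mul_ne_zero (mul_ne_zero hq0 hq1) (sub_ne_zero.mpr h1))
      (sub_ne_zero.mpr h1')) hz
    cases u <;> cases v <;> simp only [pairCoeff]
    · refine ContinuousAt.div_const ?_ _
      fun_prop
    all_goals fun_prop (disch := assumption)

theorem continuousAt_Gamma (hq0 : q ≠ 0) (hq1 : 1 - q ≠ 0) (hq2 : 1 + q ≠ 0) {n : ℕ}
    {x : ℂ → Fin n → ℂ} (hx : ∀ i, ContinuousAt (fun t => x t i) t₀)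
    (h0 : ∀ i j, i ≠ j → x t₀ i ≠ x t₀ j) (h1 : ∀ i j, i ≠ j → x t₀ i ≠ q * x t₀ j)
    (h2 : ∀ i, x t₀ i ≠ q ^ 2 * z) (h3 : ∀ i, x t₀ i ≠ q ^ 3 * z) (k : Fin 3) :
    ContinuousAt (fun t => Gamma q (x t) k z) t₀ := by
  have cd := fun i => continuousAt_d (hx i) (h2 i) (h3 i)
  have ce := fun i => continuousAt_eDot (hx i) (h2 i) (h3 i)
  have cD : ∀ i j, i ≠ j → ∀ u, ContinuousAt (fun t => dDot q (x t i) (x t j) u) t₀ :=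
    fun i j hij u => continuousAt_dDot hq2 (hx i) (hx j) (h0 i j hij) (h1 i j hij)
      (h1 j i hij.symm) u
  fin_cases k
  · exact continuousAt_tensor cd
  · change ContinuousAt (fun t => Gamma1 q (x t) z) t₀
    unfold Gamma1
    refine tendsto_finsetSum _ fun u _ => tendsto_finsetSum _ fun i _ =>
      continuousAt_tensor fun j => ?_
    by_cases hj : j = i
    · simp only [hj, if_true]
      exact ce i u
    · simp only [hj, if_false]
      exact (cd j).mul (cD j i hj u)
  · change ContinuousAt (fun t => Gamma2 q (x t) z) t₀
    unfold Gamma2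
    refine ContinuousAt.add (tendsto_finsetSum _ fun i _ => continuousAt_tensor fun j => ?_)
      (tendsto_finsetSum _ fun u _ => tendsto_finsetSum _ fun v _ => tendsto_finsetSum _ fun i _ =>
        tendsto_finsetSum _ fun j hj => ?_)
    · by_cases hj : j = i
      · simp only [hj, if_true]
        exact continuousAt_eBoth (hx i) (h2 i) (h3 i)
      · simp only [hj, if_false]
        exact (cd j).mul (continuousAt_dBoth (hx j) (hx i) (h0 j i hj) (h1 j i hj))
    · have hij : i ≠ j := (Finset.mem_Ioi.mp hj).ne
      refine ContinuousAt.smul (continuousAt_pairCoeff hq0 hq1 (hx i) (hx j) (h0 i j hij)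
        (h1 i j hij) (h1 j i hij.symm) u v) (continuousAt_tensor fun k => ?_)
      by_cases hk : k = i
      · simp only [hk, if_true]
        exact ce i u
      · by_cases hk' : k = j
        · simp only [hk', if_true, if_neg hij.symm]
          exact ce j v
        · simp only [hk, hk', if_false]
          exact ((cd k).mul (cD k i hk u)).mul (cD k j hk' v)

theorem continuousAt_list_prod {M : Type*} [Monoid M] [TopologicalSpace M] [ContinuousMul M] :
    ∀ {L : ℕ} {f : ℂ → Fin L → M}, (∀ k, ContinuousAt (fun t => f t k) t₀) →
      ContinuousAt (fun t => (List.ofFn (f t)).prod) t₀ := by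
  intro L
  induction L with
  | zero => intro f _; simpa using continuousAt_const
  | succ L ih =>
    intro f hf
    simp only [List.ofFn_succ, List.prod_cons]
    exact (hf 0).mul (ih fun k => hf k.succ)

/-- By `F_succ`, `F` is built from finitely many weights in the first `L` columns, so no topology on
`FockSpace` is involved. -/
theorem continuousAt_F {z : ℕ → ℂ} {L : ℕ} : ∀ {n : ℕ} {x : ℂ → Fin n → ℂ}
    (_ : ∀ i, ContinuousAt (fun t => x t i) t₀) (_ : ∀ i, ∀ k < L, x t₀ i ≠ q ^ 2 * z k)
    (_ : ∀ i, ∀ k < L, x t₀ i ≠ q ^ 3 * z k) (S : TwoString) (_ : ∀ k, L ≤ k → S k = 0),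
    ContinuousAt (fun t => F q (x t) z S) t₀ := by
  intro n
  induction n with
  | zero =>
    intro x _ _ _ S _
    simpa [F] using continuousAt_const
  | succ n ih =>
    intro x hx h2 h3 S hS
    simp only [F_succ q _ z S L hS]
    refine tendsto_finsetSum _ fun I _ => ContinuousAt.mul ?_ (ih (fun i => hx _)
      (fun i => h2 _) (fun i => h3 _) _ fun k hk => extend_apply_of_le I hk)
    simp only [rowOp, Matrix.of_apply]
    refine tendsto_finsetSum _ fun h _ => ?_
    split_ifs
    · exact tendsto_finsetProd _ fun k _ =>
        continuousAt_weight (hx _) (h2 _ k k.2) (h3 _ k k.2) _ _ _ _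
    · exact tendsto_const_nhds

end Continuity

/-! ### The theorem -/

theorem eventually_perturbed_ne (a b c : ℂ) {m k : ℕ} (hmk : m ≠ k) :
    ∀ᶠ t in 𝓝[≠] (0 : ℂ), a + t ^ (m + 1) ≠ c * (b + t ^ (k + 1)) := by
  let p : Polynomial ℂ := Polynomial.C a + Polynomial.X ^ (m + 1) -
    Polynomial.C c * (Polynomial.C b + Polynomial.X ^ (k + 1))
  -- The coefficient of $X^{m+1}$ in `p` is $1$: the constants do not reach this degree, and $k\ne
  -- m$.
  have hp : p ≠ 0 := by
    intro h
    have := congrArg (fun r => Polynomial.coeff r (m + 1)) h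
    simp [p, Polynomial.coeff_X_pow, hmk] at this
  have hfin : (↑p.roots.toFinset \ {0} : Set ℂ).Finite := (Finset.finite_toSet _).sdiff
  have hopen : (↑p.roots.toFinset \ {0} : Set ℂ)ᶜ ∈ 𝓝 (0 : ℂ) :=
    hfin.isClosed.isOpen_compl.mem_nhds fun h => h.2 rfl
  filter_upwards [mem_nhdsWithin_of_mem_nhds hopen, self_mem_nhdsWithin] with t ht ht0 heq
  refine ht ⟨?_, ht0⟩
  rw [Finset.mem_coe, Multiset.mem_toFinset, Polynomial.mem_roots hp]
  simp [p, Polynomial.IsRoot, heq]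

end IzerginKorepin

/-- The infinite product of twisted column operators is read as its truncations: beyond the last
nonzero entry of `S` all its factors are `Γ_0`, and every truncation that contains all nonzero
entries of `S` has the asserted matrix element. -/
theorem mainTheorem5 (q : ℂ) (N : ℕ) (hN : 0 < N) (x : Fin N → ℂ) (z : ℕ → ℂ)
    (hq0 : q ≠ 0) (hq1 : q ≠ 1) (hq2 : q ≠ -1)
    (hx : ∀ i j, i ≠ j → x i ≠ x j) (hxq : ∀ i j, i ≠ j → x i ≠ q * x j)
    (hz2 : ∀ i k, x i ≠ q ^ 2 * z k) (hz3 : ∀ i k, x i ≠ q ^ 3 * z k)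
    (S : IzerginKorepin.TwoString) (hS : S.size = 2 * N)
    (L : ℕ) (hL : ∀ k, L ≤ k → S k = 0) :
    IzerginKorepin.F q x z S =
      dotProduct (IzerginKorepin.bra2 N)
        (Matrix.mulVec (IzerginKorepin.GammaProd q x z S L) (IzerginKorepin.ket0 N)) := by
  open IzerginKorepin Filter Topology in
  have hq1' : 1 - q ≠ 0 := sub_ne_zero.mpr hq1.symm
  have hq2' : 1 + q ≠ 0 := fun h => hq2 (eq_neg_of_add_eq_zero_right h)
  rw [bra2_dotProduct_ket0]
  -- Distinct positive powers of $t$ make $y_i-c\,y_j$ a nonzero polynomial in $t$ for every $c$ and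
  -- $i\ne j$, whatever coincidences hold between the $x_i$ at $t=0$.
  let y : ℂ → Fin N → ℂ := fun t i => x i + t ^ ((i : ℕ) + 1)
  have hy0 : y 0 = x := by
    funext i
    simp [y]
  have hyc : ∀ i, ContinuousAt (fun t => y t i) 0 := fun i => by
    simp only [y]
    fun_prop
  have hgen : ∀ c : ℂ, ∀ᶠ t in 𝓝[≠] (0 : ℂ), ∀ i j, i ≠ j → y t i ≠ c * y t j := fun c => by
    refine eventually_all.mpr fun i => eventually_all.mpr fun j => ?_
    by_cases hij : i = j
    · exact Eventually.of_forall fun t h => absurd hij h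
    · filter_upwards [eventually_perturbed_ne (x i) (x j) c (Fin.val_ne_of_ne hij)] with t ht _
      exact ht
  have hz : ∀ c : ℂ, (∀ i k, x i ≠ c * z k) →
      ∀ᶠ t in 𝓝[≠] (0 : ℂ), ∀ i, ∀ k < L, y t i ≠ c * z k := fun c hc => by
    have h : ∀ᶠ t in 𝓝 (0 : ℂ), ∀ i, ∀ k : Fin L, y t i ≠ c * z k :=
      eventually_all.mpr fun i => eventually_all.mpr fun k =>
        (hyc i).eventually_ne (by rw [hy0]; exact hc i k)
    filter_upwards [mem_nhdsWithin_of_mem_nhds h] with t ht i k hk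
    exact ht i ⟨k, hk⟩
  have heq : ∀ᶠ t in 𝓝[≠] (0 : ℂ),
      F q (y t) z S = GammaProd q (y t) z S L (fun _ => 2) (fun _ => 0) := by
    filter_upwards [hgen 1, hgen q, hgen (q ^ 2), hgen (q ^ 3), hz _ hz2, hz _ hz3]
      with t h0 h1 h2 h3 h4 h5
    exact F_eq_GammaProd_of_generic hq0 hq1' hq2' z L (by simpa using h0) h1 h2 h3 h4 h5 S hL
  have cF : ContinuousAt (fun t => F q (y t) z S) 0 :=
    continuousAt_F hyc (fun i k _ => by rw [hy0]; exact hz2 i k)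
      (fun i k _ => by rw [hy0]; exact hz3 i k) S hL
  have cG : ContinuousAt (fun t => GammaProd q (y t) z S L (fun _ => 2) (fun _ => 0)) 0 := by
    have c : ContinuousAt (fun t => GammaProd q (y t) z S L) 0 := continuousAt_list_prod fun k =>
      continuousAt_Gamma hq0 hq1' hq2' hyc (by rwa [hy0]) (by rwa [hy0])
        (by rw [hy0]; exact fun i => hz2 i k) (by rw [hy0]; exact fun i => hz3 i k) _
    exact continuousAt_pi.mp (continuousAt_pi.mp c _) _
  -- Both sides are continuous at $t=0$ and agree on a punctured neighbourhood, hence agree at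
  -- $t=0$.
  have := tendsto_nhds_unique_of_eventuallyEq (cF.mono_left nhdsWithin_le_nhds)
    (cG.mono_left nhdsWithin_le_nhds) heq
  simpa only [hy0] using this
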